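/- Let $K$ be an imaginary quadratic field and let $\mathcal{O}_K$ be its ring of integers. A set $\{a_1,a_2,\dots,a_m\}\subset\mathcal{O}_K\setminus\{0\}$ of $m$ distinct nonzero elements is called a Diophantine $m$-tuple in $\mathcal{O}_K$ with property $D(-1)$ if, for all $1\le i<j\le m$, there is $x_{ij}\in\mathcal{O}_K$ with $a_ia_j-1=x_{ij}^2$. Then for every integer $m>36$ there is no Diophantine $m$-tuple in $\mathcal{O}_K$ with property $D(-1)$. -/

import Mathlib

/-- The family `a₁, …, a_m` enumerates a Diophantine `m`-tuple in the commutative ring `R` with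
property `D(n)`: the `a_i` are pairwise distinct (they form a set of `m` elements), nonzero, and
`a_i a_j + n` is a square in `R` for all `i < j`. -/
structure IsDiophantineTuple {R : Type*} [CommRing R] (n : R) {m : ℕ} (a : Fin m → R) : Prop where
  injective : Function.Injective a
  ne_zero : ∀ i, a i ≠ 0
  isSquare : ∀ i j, i < j → IsSquare (a i * a j + n)

/-! Embedded in `ℂ`, the ring of integers has integral squared absolute values, so its nonzero
elements have norm at least 1. Nothing else about the ring is used (`card_le_thirtySix`). The bound
is 36 = 16 + 20.

At most 16 members satisfy `‖x‖² ≤ 6`, by counting lattice points (`card_le_of_le_six`).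

Order the members with `‖x‖² ≥ 7` by size. Unless `regularForm` vanishes on a triple, its largest
member is at least the product of the other two; two further smaller members exclude vanishing
(`norm_mul_le_of_five`). So the logarithms grow like Fibonacci numbers, and 21 members would contain
a quadruple `a, b, c, d` with huge gaps. Write `ac - 1 = s²`, `ad - 1 = x²`, `bc - 1 = t²`, `bd - 1
= y²`, `cd - 1 = z²`. Up to sign, `bsx / (abz)` and `aty / (abz)` approximate `√(1 - 1/(ac))` and
`√(1 - 1/(bc))` too well for `one_le_pade_bound`, whence `not_quadruple_of_gaps`.

The Padé forms are residues of `(1 + zx)^(k+1/2) g(z) / ∏ (z - a_l)^(k+1)` at three nodes, with `x =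
1/N`. Their sum is small (`norm_sum_padeForm_le`), suitable multiples lie in the ring
(`scaled_padeForm_mem`), and `g = 1, z, z²` give a nonsingular matrix (`padeForm_nonsingular`).
Hence any nonzero ring vector pairs with one of the three rows to a nonzero ring element, of norm at
least 1. -/

namespace DiophantineTuple

section Pade

open PowerSeries Finset

/-! ### Reciprocal powers of linear forms as power series -/

/-- The power series `(δ + X)⁻ⁿ`. -/
noncomputable def recipPow (δ : ℂ) (n : ℕ) : ℂ⟦X⟧ := ((C δ + X)⁻¹) ^ n

lemma recipPow_zero (δ : ℂ) : recipPow δ 0 = 1 := pow_zero _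

lemma linear_mul_recipPow_succ {δ : ℂ} (hδ : δ ≠ 0) (n : ℕ) :
    (C δ + X) * recipPow δ (n + 1) = recipPow δ n := by
  have h : (C δ + X : ℂ⟦X⟧) * (C δ + X)⁻¹ = 1 :=
    PowerSeries.mul_inv_cancel _ (by simpa using hδ)
  rw [recipPow, recipPow, pow_succ', ← mul_assoc, h, one_mul]

lemma derivative_recipPow (δ : ℂ) (n : ℕ) :
    d⁄dX ℂ (recipPow δ n) = -(n : ℂ⟦X⟧) * recipPow δ (n + 1) := by
  rcases n with _ | n
  · simp [recipPow]
  · simp only [recipPow, derivative_pow, derivative_inv', map_add, derivative_C, derivative_X]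
    push_cast
    ring

lemma coeff_recipPow_succ {δ : ℂ} (hδ : δ ≠ 0) (n m : ℕ) :
    coeff m (recipPow δ (n + 1)) = (-1) ^ m * ((n + m).choose n : ℂ) / δ ^ (n + 1 + m) := by
  induction n generalizing m with
  | zero =>
    induction m with
    | zero =>
      have h := congrArg (coeff 0) (linear_mul_recipPow_succ hδ 0)
      simp [recipPow_zero] at h
      simp only [coeff_zero_eq_constantCoeff]
      field_simp
      simpa [mul_comm] using h
    | succ m ih =>
      have h := congrArg (coeff (m + 1)) (linear_mul_recipPow_succ hδ 0)
      rw [recipPow_zero, add_mul, map_add, coeff_C_mul, coeff_succ_X_mul, ih, coeff_one] at h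
      simp at h ⊢
      field_simp at h ⊢
      linear_combination h
  | succ n ihn =>
    induction m with
    | zero =>
      have h := congrArg (coeff 0) (linear_mul_recipPow_succ hδ (n + 1))
      rw [ihn, add_mul, map_add, coeff_C_mul, coeff_zero_X_mul] at h
      simp only [add_zero, Nat.choose_self] at h ⊢
      field_simp at h ⊢
      linear_combination h
    | succ m ih =>
      have h := congrArg (coeff (m + 1)) (linear_mul_recipPow_succ hδ (n + 1))
      rw [ihn, add_mul, map_add, coeff_C_mul, coeff_succ_X_mul, ih] at h
      have hc : ((n + 1 + (m + 1)).choose (n + 1) : ℂ)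
          = ((n + (m + 1)).choose n : ℂ) + ((n + 1 + m).choose (n + 1) : ℂ) := by
        rw [show n + 1 + (m + 1) = (n + m + 1) + 1 by ring, Nat.choose_succ_succ]
        push_cast
        congr 3
        ring
      rw [hc]
      field_simp at h ⊢
      rw [show n + 1 + 1 + (m + 1) = n + m + 3 by ring]
      rw [show n + 1 + 1 + m = n + m + 2 by ring, show n + 1 + (m + 1) = n + m + 2 by ring] at h
      field_simp at h
      linear_combination h

/-! ### Sums of residues of rational functions -/

section SumRes

variable {ι : Type*} [Fintype ι] [DecidableEq ι]

/-- The residue at `a j` of `f(z) / ∏ (z - a l) ^ (n l)`. -/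
noncomputable def res (a : ι → ℂ) (n : ι → ℕ) (j : ι) (f : Polynomial ℂ) : ℂ :=
  coeff (n j) (X * (Polynomial.aeval (C (a j) + X : ℂ⟦X⟧) f
    * ∏ l ∈ univ.erase j, recipPow (a j - a l) (n l)))

/-- The sum of all residues of `f(z) / ∏ (z - a l) ^ (n l)`. -/
noncomputable def sumRes (a : ι → ℂ) (n : ι → ℕ) (f : Polynomial ℂ) : ℂ :=
  ∑ j, res a n j f

lemma sumRes_add (a : ι → ℂ) (n : ι → ℕ) (f g : Polynomial ℂ) :
    sumRes a n (f + g) = sumRes a n f + sumRes a n g := by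
  simp [sumRes, res, add_mul, mul_add, sum_add_distrib]

lemma sumRes_C_mul (a : ι → ℂ) (n : ι → ℕ) (r : ℂ) (f : Polynomial ℂ) :
    sumRes a n (Polynomial.C r * f) = r * sumRes a n f := by
  simp only [sumRes, res, map_mul, Polynomial.aeval_C, mul_sum]
  refine sum_congr rfl fun j _ => ?_
  rw [show (algebraMap ℂ ℂ⟦X⟧) r = C r from rfl, ← coeff_C_mul]
  congr 1
  ring

lemma aeval_linear_mul (α β : ℂ) (f : Polynomial ℂ) :
    Polynomial.aeval (C α + X : ℂ⟦X⟧) ((Polynomial.X - Polynomial.C β) * f)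
      = (C (α - β) + X) * Polynomial.aeval (C α + X : ℂ⟦X⟧) f := by
  rw [map_mul, map_sub, Polynomial.aeval_X, Polynomial.aeval_C, map_sub C,
    show (algebraMap ℂ ℂ⟦X⟧) β = C β from rfl]
  ring

/-- A factor `z - a i` lowers the order of the pole at `a i` by one and leaves the rational function
unchanged at the other nodes. -/
lemma sumRes_linear_mul {a : ι → ℂ} (ha : Function.Injective a) (n : ι → ℕ) (i : ι)
    (f : Polynomial ℂ) :
    sumRes a (Function.update n i (n i + 1)) ((Polynomial.X - Polynomial.C (a i)) * f)
      = sumRes a n f := by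
  refine sum_congr rfl fun j _ => ?_
  unfold res
  by_cases hj : j = i
  · subst hj
    rw [Function.update_self]
    have : ∏ l ∈ univ.erase j, recipPow (a j - a l) (Function.update n j (n j + 1) l)
        = ∏ l ∈ univ.erase j, recipPow (a j - a l) (n l) :=
      prod_congr rfl fun l hl => by rw [Function.update_of_ne (ne_of_mem_erase hl)]
    rw [this, aeval_linear_mul, sub_self, map_zero, zero_add, coeff_succ_X_mul, mul_assoc]
  · rw [Function.update_of_ne hj, aeval_linear_mul]
    have hi : i ∈ univ.erase j := mem_erase.2 ⟨Ne.symm hj, mem_univ _⟩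
    rw [← mul_prod_erase _ _ hi, ← mul_prod_erase _ (fun l => recipPow (a j - a l) (n l)) hi,
      Function.update_self]
    have : ∏ l ∈ (univ.erase j).erase i, recipPow (a j - a l) (Function.update n i (n i + 1) l)
        = ∏ l ∈ (univ.erase j).erase i, recipPow (a j - a l) (n l) :=
      prod_congr rfl fun l hl => by rw [Function.update_of_ne (ne_of_mem_erase hl)]
    rw [this, ← linear_mul_recipPow_succ (sub_ne_zero.2 fun h => hj (ha h)) (n i)]
    congr 1
    ring

lemma sumRes_X_mul {a : ι → ℂ} (ha : Function.Injective a) (n : ι → ℕ) (i : ι)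
    (f : Polynomial ℂ) :
    sumRes a (Function.update n i (n i + 1)) (Polynomial.X * f)
      = a i * sumRes a (Function.update n i (n i + 1)) f + sumRes a n f := by
  rw [← sumRes_linear_mul ha n i f, ← sumRes_C_mul, ← sumRes_add]
  congr 1
  ring

lemma sumRes_single (a : ι → ℂ) (i : ι) (m : ℕ) (f : Polynomial ℂ) :
    sumRes a (Pi.single i (m + 1)) f = coeff m (Polynomial.aeval (C (a i) + X : ℂ⟦X⟧) f) := by
  rw [sumRes, sum_eq_single i]
  · have : ∏ l ∈ univ.erase i, recipPow (a i - a l) ((Pi.single i (m + 1) : ι → ℕ) l) = 1 :=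
      prod_eq_one fun l hl => by rw [Pi.single_eq_of_ne (ne_of_mem_erase hl), recipPow_zero]
    rw [res, this, Pi.single_eq_same, coeff_succ_X_mul, mul_one]
  · intro j _ hj
    -- The factor `X` in `res` makes a node of exponent zero contribute nothing.
    rw [res, Pi.single_eq_of_ne hj, coeff_zero_X_mul]
  · simp

lemma exists_eq_update {n : ι → ℕ} {i : ι} (hi : n i ≠ 0) :
    ∃ n₀ : ι → ℕ, n = Function.update n₀ i (n₀ i + 1) ∧ ∑ j, n j = ∑ j, n₀ j + 1 ∧
      ∀ j ≠ i, n₀ j = n j := by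
  refine ⟨Function.update n i (n i - 1), ?_, ?_, fun j hj => Function.update_of_ne hj _ _⟩
  · rw [Function.update_self, Function.update_idem, Nat.sub_add_cancel (Nat.pos_of_ne_zero hi),
      Function.update_eq_self]
  · rw [← add_sum_erase _ _ (mem_univ i), ← add_sum_erase _ _ (mem_univ i), Function.update_self,
      sum_congr rfl fun j hj => Function.update_of_ne (ne_of_mem_erase hj) _ n]
    have e : (univ.erase i).sum n = ∑ j ∈ univ.erase i, n j := rfl
    omega

/-- The rational function `1 / ∏ (z - a l) ^ (n l)` of degree `≤ -2` has no residue at infinity. -/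
lemma sumRes_one {a : ι → ℂ} (ha : Function.Injective a) (s : ℕ) :
    ∀ n : ι → ℕ, ∑ j, n j = s + 1 → sumRes a n 1 = if s = 0 then 1 else 0 := by
  induction s with
  | zero =>
    intro n hn
    obtain ⟨i, hi⟩ : ∃ i, n i ≠ 0 := by
      by_contra! h
      simp [h] at hn
    have hle : ∀ j ≠ i, n j = 0 := by
      intro j hj
      have h1 := sum_le_univ_sum_of_nonneg (s := {i, j}) (f := n) (fun _ => Nat.zero_le _)
      rw [sum_pair (Ne.symm hj), hn] at h1
      omega
    have : n = Pi.single i (0 + 1) := by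
      ext j
      by_cases hj : j = i
      · subst hj
        have h1 := single_le_sum (f := n) (fun _ _ => Nat.zero_le _) (mem_univ j)
        rw [hn] at h1
        rw [Pi.single_eq_same]
        omega
      · rw [hle j hj, Pi.single_eq_of_ne hj]
    rw [this, sumRes_single]
    simp
  | succ s ih =>
    intro n hn
    rw [if_neg (Nat.succ_ne_zero s)]
    obtain ⟨i, hi⟩ : ∃ i, n i ≠ 0 := by
      by_contra! h
      simp [h] at hn
    by_cases hex : ∃ j ≠ i, n j ≠ 0
    · obtain ⟨j, hji, hj⟩ := hex
      obtain ⟨n₁, h₁, hs₁, -⟩ := exists_eq_update hi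
      obtain ⟨n₂, h₂, hs₂, -⟩ := exists_eq_update hj
      have e₁ := sumRes_X_mul ha n₁ i 1
      have e₂ := sumRes_X_mul ha n₂ j 1
      rw [← h₁, ih n₁ (by omega)] at e₁
      rw [← h₂, ih n₂ (by omega), e₁] at e₂
      -- The residue sum for numerator `z` is computed with `z = a i + (z - a i)` and with `z = a j
      -- + (z - a j)`. The remainders agree by induction, also for `s = 0`, where both are 1.
      have : (a i - a j) * sumRes a n 1 = 0 := by linear_combination e₂
      exact (mul_eq_zero.1 this).resolve_left (sub_ne_zero.2 fun h => hji (ha h).symm)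
    · push Not at hex
      have : n = Pi.single i (s + 1 + 1) := by
        ext j
        by_cases hj : j = i
        · subst hj
          rw [Pi.single_eq_same, ← hn, sum_eq_single j (fun b _ hb => hex b hb) (by simp)]
        · rw [hex j hj, Pi.single_eq_of_ne hj]
      rw [this, sumRes_single]
      simp [coeff_one]

/-- The residue sum is the complete homogeneous symmetric polynomial of degree `m - s` in the `s +
1` nodes counted with multiplicity, which has `m.choose s` monomials and vanishes for `m < s`. -/
lemma norm_sumRes_X_pow_le {a : ι → ℂ} (ha : Function.Injective a) {M : ℝ}
    (hM : ∀ i, ‖a i‖ ≤ M) (m : ℕ) :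
    ∀ (n : ι → ℕ) (s : ℕ), ∑ j, n j = s + 1 →
      ‖sumRes a n (Polynomial.X ^ m)‖ ≤ m.choose s * M ^ (m - s) := by
  induction m with
  | zero =>
    intro n s hn
    rw [pow_zero, sumRes_one ha s n hn]
    split_ifs with h <;> simp [h]
  | succ m ih =>
    intro n s hn
    obtain ⟨i, hi⟩ : ∃ i, n i ≠ 0 := by
      by_contra! h
      simp [h] at hn
    have hM0 : 0 ≤ M := (norm_nonneg _).trans (hM i)
    obtain ⟨n₀, h', hs', -⟩ := exists_eq_update hi
    have e := sumRes_X_mul ha n₀ i (Polynomial.X ^ m)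
    rw [← h', ← pow_succ'] at e
    rw [e]
    have h1 : ‖a i * sumRes a n (Polynomial.X ^ m)‖ ≤ M * (m.choose s * M ^ (m - s)) := by
      rw [norm_mul]
      exact mul_le_mul (hM i) (ih n s hn) (norm_nonneg _) hM0
    have h1' : M * (m.choose s * M ^ (m - s)) = m.choose s * M ^ (m + 1 - s) := by
      by_cases hsm : s ≤ m
      · rw [Nat.succ_sub hsm, pow_succ]; ring
      · rw [Nat.choose_eq_zero_of_lt (not_le.1 hsm)]; simp
    rcases s with _ | s
    · have : sumRes a n₀ (Polynomial.X ^ m) = 0 := by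
        have h0 : ∀ j, n₀ j = 0 := by
          have : ∑ j, n₀ j = 0 := by omega
          simpa using this
        simp [sumRes, res, h0]
      rw [this, add_zero]
      refine h1.trans ?_
      rw [h1']
      simp
    · have h2 := ih n₀ s (by omega)
      refine (norm_add_le _ _).trans ((add_le_add h1 h2).trans (le_of_eq ?_))
      rw [h1', Nat.choose_succ_succ m s, Nat.add_sub_add_right]
      push_cast
      ring

end SumRes

/-! ### Binomial coefficients of half-integers -/

lemma succ_mul_choose_succ (r : ℂ) (n : ℕ) :
    ((n : ℂ) + 1) * Ring.choose r (n + 1) = (r - n) * Ring.choose r n := by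
  have h := Ring.choose_smul_choose r (Nat.le_succ n)
  rw [Nat.succ_sub (le_refl n), Nat.sub_self, Ring.choose_one_right, Nat.succ_eq_add_one,
    Nat.choose_succ_self_right, nsmul_eq_mul] at h
  push_cast at h
  rw [h, mul_comm]

lemma four_pow_mul_choose_neg_half (n : ℕ) :
    4 ^ n * Ring.choose (-1 / 2 : ℂ) n = (-1) ^ n * (n.centralBinom : ℂ) := by
  induction n with
  | zero => simp
  | succ n ih =>
    have h1 := succ_mul_choose_succ (-1 / 2) n
    have h2 : ((n : ℂ) + 1) * ((n + 1).centralBinom : ℂ)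
        = 2 * (2 * n + 1) * (n.centralBinom : ℂ) := by
      exact_mod_cast Nat.succ_mul_centralBinom_succ n
    have hn : (n : ℂ) + 1 ≠ 0 := Nat.cast_add_one_ne_zero n
    apply mul_left_cancel₀ hn
    linear_combination 4 ^ (n + 1) * h1 + 4 * (-1 / 2 - n) * ih - (-1) ^ (n + 1) * h2

lemma norm_choose_neg_half_le (n : ℕ) : ‖Ring.choose (-1 / 2 : ℂ) n‖ ≤ 1 := by
  induction n with
  | zero => simp
  | succ n ih =>
    have h1 := congrArg norm (succ_mul_choose_succ (-1 / 2) n)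
    rw [norm_mul, norm_mul, show (-1 / 2 - n : ℂ) = ((-(1 / 2 + n) : ℝ) : ℂ) by push_cast; ring,
      Complex.norm_real, norm_neg, Real.norm_of_nonneg (by positivity),
      show (n : ℂ) + 1 = ((n + 1 : ℝ) : ℂ) by push_cast; ring, Complex.norm_real,
      Real.norm_of_nonneg (by positivity)] at h1
    have hn : (0 : ℝ) < n + 1 := by positivity
    by_contra! hc
    nlinarith [mul_lt_mul_of_pos_left hc hn,
      mul_le_mul_of_nonneg_left ih (show (0 : ℝ) ≤ 1 / 2 + n by positivity)]

/-- Pascal's rule lowers the upper index to `-1/2`, where a signed central binomial coefficient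
appears. -/
lemma exists_int_four_pow_mul_choose (k n : ℕ) :
    ∃ z : ℤ, 4 ^ n * Ring.choose ((k : ℂ) - 1 / 2) n = z := by
  induction k generalizing n with
  | zero =>
    refine ⟨(-1) ^ n * n.centralBinom, ?_⟩
    have := four_pow_mul_choose_neg_half n
    push_cast
    rw [← this]
    ring_nf
  | succ k ih =>
    rcases n with _ | n
    · exact ⟨1, by simp⟩
    · obtain ⟨y, hy⟩ := ih n
      obtain ⟨z, hz⟩ := ih (n + 1)
      refine ⟨4 * y + z, ?_⟩
      rw [show ((k + 1 : ℕ) : ℂ) - 1 / 2 = (k : ℂ) - 1 / 2 + 1 by push_cast; ring,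
        Ring.choose_succ_succ]
      push_cast
      rw [← hy, ← hz]
      ring

lemma norm_choose_le (k n : ℕ) : ‖Ring.choose ((k : ℂ) - 1 / 2) n‖ ≤ 2 ^ k := by
  induction k generalizing n with
  | zero =>
    have := norm_choose_neg_half_le n
    simpa [neg_div] using this
  | succ k ih =>
    rcases n with _ | n
    · simpa using one_le_pow₀ (one_le_two : (1 : ℝ) ≤ 2)
    · rw [show ((k + 1 : ℕ) : ℂ) - 1 / 2 = (k : ℂ) - 1 / 2 + 1 by push_cast; ring,
        Ring.choose_succ_succ, pow_succ]
      linarith [norm_add_le (Ring.choose ((k : ℂ) - 1 / 2) n)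
        (Ring.choose ((k : ℂ) - 1 / 2) (n + 1)), ih n, ih (n + 1)]

lemma exists_int_four_pow_mul_choose_half (k n : ℕ) :
    ∃ z : ℤ, 4 ^ n * Ring.choose ((k : ℂ) + 1 / 2) n = z := by
  obtain ⟨z, hz⟩ := exists_int_four_pow_mul_choose (k + 1) n
  refine ⟨z, ?_⟩
  rw [← hz]
  congr 2
  push_cast
  ring

lemma norm_choose_half_le (k n : ℕ) : ‖Ring.choose ((k : ℂ) + 1 / 2) n‖ ≤ 2 ^ (k + 1) := by
  convert norm_choose_le (k + 1) n using 3
  push_cast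
  ring

/-! ### Simultaneous Padé forms -/

/-- The expansion of `(e + x X) ^ (k + 1/2) / e ^ (1/2)`. -/
noncomputable def halfPow (k : ℕ) (x e : ℂ) : ℂ⟦X⟧ :=
  mk fun h => Ring.choose ((k : ℂ) + 1 / 2) h * x ^ h * e ^ ((k : ℤ) - h)

/-- The differential equation of `(e + x X)^(k+1/2)`, the only property of this series that
`padeForm_exactNumerator` needs. -/
lemma linear_mul_derivative_halfPow (k : ℕ) (x : ℂ) {e : ℂ} (he : e ≠ 0) :
    (C e + C x * X) * d⁄dX ℂ (halfPow k x e) = C (((k : ℂ) + 1 / 2) * x) * halfPow k x e := by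
  ext h
  have hs := succ_mul_choose_succ ((k : ℂ) + 1 / 2)
  have hz : ∀ h : ℕ, e * e ^ ((k : ℤ) - (h + 1 : ℕ)) = e ^ ((k : ℤ) - h) := fun h => by
    rw [← zpow_one_add₀ he]
    congr 1
    push_cast
    ring
  rw [add_mul, map_add, coeff_C_mul, mul_assoc, coeff_C_mul, coeff_C_mul]
  rcases h with _ | h
  · rw [coeff_zero_X_mul, coeff_derivative, halfPow, coeff_mk, coeff_mk]
    have h0 := hs 0
    have z0 := hz 0
    rw [← z0]
    simp only [Ring.choose_zero_right, Nat.cast_zero, zero_add] at h0 ⊢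
    linear_combination x * e * e ^ ((k : ℤ) - (1 : ℕ)) * h0
  · rw [coeff_succ_X_mul, coeff_derivative, coeff_derivative, halfPow, coeff_mk, coeff_mk]
    have h0 := hs (h + 1)
    have z0 := hz (h + 1)
    rw [← z0]
    push_cast at h0 z0 ⊢
    linear_combination x ^ (h + 1 + 1) * e * e ^ ((k : ℤ) - (h + 1 + 1)) * h0

/-- The local factor of the Padé forms at the node `a j`. -/
noncomputable def padeKernel (a : Fin 3 → ℂ) (x : ℂ) (k : ℕ) (j : Fin 3) : ℂ⟦X⟧ :=
  halfPow k x (1 + a j * x) * ∏ l ∈ univ.erase j, recipPow (a j - a l) (k + 1)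

/-- The coefficient at `(1 + a j x) ^ (1/2)` of the Padé form attached to the polynomial `g`: up to
that square root, the residue at `a j` of `(1 + z x) ^ (k + 1/2) g(z) / ∏ (z - a l) ^ (k + 1)`. -/
noncomputable def padeForm (a : Fin 3 → ℂ) (x : ℂ) (k : ℕ) (j : Fin 3) :
    Polynomial ℂ →ₗ[ℂ] ℂ :=
  (coeff k).comp ((LinearMap.mulLeft ℂ (padeKernel a x k j)).comp
    (Polynomial.aeval (C (a j) + X : ℂ⟦X⟧)).toLinearMap)

lemma padeForm_apply (a : Fin 3 → ℂ) (x : ℂ) (k : ℕ) (j : Fin 3) (g : Polynomial ℂ) :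
    padeForm a x k j g
      = coeff k (padeKernel a x k j * Polynomial.aeval (C (a j) + X : ℂ⟦X⟧) g) := rfl

lemma prod_erase_fin_three {M : Type*} [CommMonoid M] (f : Fin 3 → M) (j : Fin 3) :
    ∏ l ∈ univ.erase j, f l = f (j + 1) * f (j + 2) := by
  have h : ∀ j : Fin 3, univ.erase j = {j + 1, j + 2} := by decide
  have h' : ∀ j : Fin 3, j + 1 ≠ j + 2 := by decide
  rw [h j, prod_pair (h' j)]

lemma fin_three_ne_add_one (j : Fin 3) : j ≠ j + 1 := by revert j; decide

lemma fin_three_ne_add_two (j : Fin 3) : j ≠ j + 2 := by revert j; decide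

lemma fin_three_cases (j : Fin 3) : j = 0 ∨ j = 1 ∨ j = 2 := by revert j; decide

lemma aeval_linear (α β : ℂ) :
    Polynomial.aeval (C α + X : ℂ⟦X⟧) (Polynomial.X - Polynomial.C β) = C (α - β) + X := by
  simpa using aeval_linear_mul α β 1

lemma coeff_X_mul_derivative_sub (W : ℂ⟦X⟧) (k : ℕ) :
    coeff k (X * d⁄dX ℂ W - C (k : ℂ) * W) = 0 := by
  rw [map_sub, coeff_C_mul]
  rcases k with _ | k
  · simp
  · rw [coeff_succ_X_mul, coeff_derivative]
    push_cast
    ring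

/-- The numerator of the derivative of `(1 + z x) ^ (k + 3/2) z ^ m / ∏ (z - a l) ^ k`. -/
noncomputable def exactNumerator (a : Fin 3 → ℂ) (x : ℂ) (k m : ℕ) : Polynomial ℂ :=
  let A := (Polynomial.X - Polynomial.C (a 0)) * (Polynomial.X - Polynomial.C (a 1))
    * (Polynomial.X - Polynomial.C (a 2))
  let dA := (Polynomial.X - Polynomial.C (a 1)) * (Polynomial.X - Polynomial.C (a 2))
    + (Polynomial.X - Polynomial.C (a 0)) * (Polynomial.X - Polynomial.C (a 2))
    + (Polynomial.X - Polynomial.C (a 0)) * (Polynomial.X - Polynomial.C (a 1))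
  Polynomial.C (((k : ℂ) + 3 / 2) * x) * Polynomial.X ^ m * A
    + Polynomial.C (m : ℂ) * Polynomial.X ^ (m - 1) * (1 + Polynomial.C x * Polynomial.X) * A
    - Polynomial.C (k : ℂ) * (1 + Polynomial.C x * Polynomial.X) * Polynomial.X ^ m * dA

/-- An exact derivative has no residue: if the primitive is `W / X^k` near the node, the residue is
the `k`-th coefficient of `X W' - k W`. -/
lemma padeForm_exactNumerator {a : Fin 3 → ℂ} (ha : Function.Injective a) {x : ℂ} {j : Fin 3}
    (he : 1 + a j * x ≠ 0) (k m : ℕ) : padeForm a x k j (exactNumerator a x k m) = 0 := by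
  set δ₁ := a j - a (j + 1) with hδ₁
  set δ₂ := a j - a (j + 2) with hδ₂
  have h₁ : δ₁ ≠ 0 := sub_ne_zero.2 fun h => fin_three_ne_add_one j (ha h)
  have h₂ : δ₂ ≠ 0 := sub_ne_zero.2 fun h => fin_three_ne_add_two j (ha h)
  set α := a j with hα
  have hG : Polynomial.aeval (C α + X : ℂ⟦X⟧) (exactNumerator a x k m)
      = C (((k : ℂ) + 3 / 2) * x) * (C α + X) ^ m * (X * (C δ₁ + X) * (C δ₂ + X))
        + C (m : ℂ) * (C α + X) ^ (m - 1) * (C (1 + α * x) + C x * X)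
          * (X * (C δ₁ + X) * (C δ₂ + X))
        - C (k : ℂ) * (C (1 + α * x) + C x * X) * (C α + X) ^ m
          * ((C δ₁ + X) * (C δ₂ + X) + X * (C δ₂ + X) + X * (C δ₁ + X)) := by
    have key : ∀ r : ℂ, (algebraMap ℂ ℂ⟦X⟧) r = C r := fun _ => rfl
    simp only [exactNumerator, map_add, map_sub, map_mul, map_pow, map_one, Polynomial.aeval_X,
      Polynomial.aeval_C, key, hδ₁, hδ₂, hα]
    obtain rfl | rfl | rfl := fin_three_cases j
    · simp only [zero_add]
      ring
    · simp only [show (1 + 1 : Fin 3) = 2 from rfl, show (1 + 2 : Fin 3) = 0 from rfl]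
      ring
    · simp only [show (2 + 1 : Fin 3) = 0 from rfl, show (2 + 2 : Fin 3) = 1 from rfl]
      ring
  have hU := linear_mul_derivative_halfPow k x he
  have r₁ := linear_mul_recipPow_succ h₁ k
  have r₂ := linear_mul_recipPow_succ h₂ k
  have hd : d⁄dX ℂ ((C α + X : ℂ⟦X⟧) ^ m) = C (m : ℂ) * (C α + X) ^ (m - 1) := by
    rw [derivative_pow]
    simp
  rw [padeForm_apply, padeKernel, prod_erase_fin_three, hG, ← hδ₁, ← hδ₂,
    ← coeff_X_mul_derivative_sub ((C (1 + α * x) + C x * X) * halfPow k x (1 + α * x)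
      * (C α + X) ^ m * (recipPow δ₁ k * recipPow δ₂ k)) k]
  congr 1
  have hC : C (((k : ℂ) + 3 / 2) * x) = C (((k : ℂ) + 1 / 2) * x) + C x := by
    rw [← map_add]
    congr 1
    ring
  have hk : ((k : ℕ) : ℂ⟦X⟧) = C (k : ℂ) := (map_natCast C k).symm
  simp only [Derivation.leibniz, smul_eq_mul, derivative_recipPow, hd, map_add (d⁄dX ℂ),
    derivative_C, derivative_X, hC, hk]
  simp only [← r₁, ← r₂]
  linear_combination -(X * (C α + X) ^ m * ((C δ₁ + X) * recipPow δ₁ (k + 1))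
    * ((C δ₂ + X) * recipPow δ₂ (k + 1))) * hU

/-- A functional vanishing on all exact numerators is determined by its first three moments. -/
lemma moments_eq_zero {a : Fin 3 → ℂ} {x : ℂ} (hx : x ≠ 0) {k : ℕ} (Φ : Polynomial ℂ →ₗ[ℂ] ℂ)
    (hΦ : ∀ m, Φ (exactNumerator a x k m) = 0)
    (h : ∀ g : Fin 3, Φ (Polynomial.X ^ (g : ℕ)) = 0) (n : ℕ) : Φ (Polynomial.X ^ n) = 0 := by
  induction n using Nat.strong_induction_on with
  | _ n ih =>
    by_cases hn : n < 3
    · exact h ⟨n, hn⟩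
    obtain ⟨m, rfl⟩ : ∃ m, n = m + 3 := ⟨n - 3, by omega⟩
    set s₁ := a 0 + a 1 + a 2
    set s₂ := a 0 * a 1 + a 0 * a 2 + a 1 * a 2
    set s₃ := a 0 * a 1 * a 2
    have hG : exactNumerator a x k m = (x * (m + 3 / 2 - 2 * k)) • Polynomial.X ^ (m + 3)
        + (-(k + 3 / 2) * x * s₁ - m * x * s₁ + m - 3 * k + 2 * k * s₁ * x)
          • Polynomial.X ^ (m + 2)
        + ((k + 3 / 2) * x * s₂ + m * x * s₂ - m * s₁ + 2 * k * s₁ - k * s₂ * x)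
          • Polynomial.X ^ (m + 1)
        + (-(k + 3 / 2) * x * s₃ - m * x * s₃ + m * s₂ - k * s₂) • Polynomial.X ^ m
        - (m * s₃) • Polynomial.X ^ (m - 1) := by
      simp only [exactNumerator, Polynomial.smul_eq_C_mul, map_add, map_sub, map_mul, map_neg,
        s₁, s₂, s₃, map_ofNat]
      -- For `m = 0` the truncated exponent `m - 1` comes with coefficient zero.
      rcases m with _ | m
      · simp
        ring
      · simp only [Nat.add_sub_cancel]
        ring
    have h0 := hΦ m
    rw [hG] at h0
    simp only [map_add, map_sub, map_smul, ih (m + 2) (by omega), ih (m + 1) (by omega),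
      ih m (by omega), ih (m - 1) (by omega), mul_zero, add_zero, sub_zero, smul_eq_mul] at h0
    refine (mul_eq_zero.1 h0).resolve_left (mul_ne_zero hx fun hc => ?_)
    -- Twice the leading factor is an odd integer, hence nonzero, so lower moments determine the top
    -- one.
    have : (2 * (m : ℤ) + 3 - 4 * k : ℤ) = 0 := by
      have h2 : (2 * (m : ℂ) + 3 - 4 * k) = 0 := by linear_combination 2 * hc
      exact_mod_cast h2
    omega

/-- The matrix of Padé forms attached to `1, z, z²` is nonsingular. -/
lemma padeForm_nonsingular {a : Fin 3 → ℂ} (ha : Function.Injective a) {x : ℂ} (hx : x ≠ 0)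
    (he : ∀ j, 1 + a j * x ≠ 0) (k : ℕ) {v : Fin 3 → ℂ}
    (h : ∀ g : Fin 3, ∑ j, v j * padeForm a x k j (Polynomial.X ^ (g : ℕ)) = 0) : v = 0 := by
  set Φ : Polynomial ℂ →ₗ[ℂ] ℂ := ∑ j, v j • padeForm a x k j with hΦdef
  have hΦ : ∀ g, Φ g = ∑ j, v j * padeForm a x k j g := fun g => by
    simp [hΦdef, LinearMap.sum_apply]
  have hz : Φ = 0 := by
    apply Polynomial.lhom_ext'
    intro n
    ext
    have := moments_eq_zero (a := a) hx (k := k) Φ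
      (fun m => by simp [hΦ, padeForm_exactNumerator ha (he _)]) (fun g => by rw [hΦ, h]) n
    simpa [Polynomial.monomial_one_right_eq_X_pow] using this
  ext j
  -- This test polynomial leaves a simple pole at `a j` and none at the other nodes, so only `v j *
  -- (1 + a j * x) ^ k` survives.
  have key := hΦ ((Polynomial.X - Polynomial.C (a j)) ^ k
    * ∏ l ∈ univ.erase j, (Polynomial.X - Polynomial.C (a l)) ^ (k + 1))
  have haeval : ∀ α : ℂ, Polynomial.aeval (C α + X : ℂ⟦X⟧)
      ((Polynomial.X - Polynomial.C (a j)) ^ k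
        * ∏ l ∈ univ.erase j, (Polynomial.X - Polynomial.C (a l)) ^ (k + 1))
      = (C (α - a j) + X) ^ k * ∏ l ∈ univ.erase j, (C (α - a l) + X) ^ (k + 1) := fun α => by
    rw [map_mul, map_prod]
    simp only [map_pow, aeval_linear]
  rw [hz, LinearMap.zero_apply, sum_eq_single j] at key
  · have h1 : padeForm a x k j ((Polynomial.X - Polynomial.C (a j)) ^ k
        * ∏ l ∈ univ.erase j, (Polynomial.X - Polynomial.C (a l)) ^ (k + 1))
        = (1 + a j * x) ^ k := by
      have hone : (∏ l ∈ univ.erase j, recipPow (a j - a l) (k + 1))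
          * ∏ l ∈ univ.erase j, (C (a j - a l) + X : ℂ⟦X⟧) ^ (k + 1) = 1 := by
        rw [← prod_mul_distrib]
        refine prod_eq_one fun l hl => ?_
        rw [recipPow, ← mul_pow, PowerSeries.inv_mul_cancel, one_pow]
        simpa using sub_ne_zero.2 fun h => (ne_of_mem_erase hl) (ha h).symm
      rw [padeForm_apply, padeKernel, haeval, sub_self, map_zero, zero_add]
      rw [show ∀ A B D E : ℂ⟦X⟧, A * B * (D * E) = A * D * (B * E) by intros; ring, hone, mul_one]
      have := coeff_mul_X_pow (halfPow k x (1 + a j * x)) k 0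
      rw [zero_add] at this
      rw [this, halfPow, coeff_mk]
      simp
    rw [h1] at key
    exact (mul_eq_zero.1 key.symm).resolve_right (pow_ne_zero _ (he j))
  · intro i _ hij
    rw [padeForm_apply, haeval, ← mul_prod_erase _ _ (mem_erase.2 ⟨hij, mem_univ i⟩), sub_self,
      map_zero, zero_add]
    refine mul_eq_zero_of_right _ (X_pow_dvd_iff.1 ?_ k (Nat.lt_succ_self k))
    exact Dvd.dvd.mul_left (Dvd.dvd.mul_left (Dvd.intro _ rfl) _) _
  · simp

/-! ### Smallness of the Padé forms -/

lemma hasSum_of_forall_eq {E : Type*} [AddCommMonoid E] [TopologicalSpace E] {f g : ℕ → E} {s : E}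
    (h : ∀ n, f n = g n) (hg : HasSum g s) : HasSum f s := by
  rwa [funext h]

lemma hasSum_choose_cpow {y : ℂ} (hy : ‖y‖ < 1) (r : ℂ) :
    HasSum (fun n : ℕ => Ring.choose r n * y ^ n) ((1 + y) ^ r) := by
  have h := (Complex.one_add_cpow_hasFPowerSeriesOnBall_zero (a := r)).hasSum
    (y := y) (by
      rw [Metric.mem_eball, edist_zero_right, ← ofReal_norm]
      exact ENNReal.ofReal_lt_one.2 hy)
  simp only [binomialSeries_apply, zero_add, List.ofFn_const, List.prod_replicate,
    smul_eq_mul] at h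
  exact h

/-- The `h`-th Taylor coefficient of `(1 + zx)^(k+1/2)` at `α`, read off the expansion at 0 through
`C(r,n) C(n,h) = C(r,h) C(r-h,n-h)`. The square root omitted from `halfPow` is restored here. -/
lemma hasSum_choose_mul_coeff {α x : ℂ} (hy : ‖α * x‖ < 1) (k h : ℕ) :
    HasSum (fun n : ℕ => Ring.choose ((k : ℂ) + 1 / 2) n * x ^ n * (n.choose h * α ^ (n - h)))
      ((1 + α * x) ^ (1 / 2 : ℂ) * coeff h (halfPow k x (1 + α * x))) := by
  set r : ℂ := (k : ℂ) + 1 / 2 with hr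
  have he : 1 + α * x ≠ 0 := by
    intro h0
    have : α * x = -1 := by linear_combination h0
    rw [this] at hy
    simp at hy
  have hs := (hasSum_choose_cpow hy (r - h)).mul_left (Ring.choose r h * x ^ h)
  have hval : Ring.choose r h * x ^ h * (1 + α * x) ^ (r - h)
      = (1 + α * x) ^ (1 / 2 : ℂ) * coeff h (halfPow k x (1 + α * x)) := by
    rw [halfPow, coeff_mk, ← Complex.cpow_intCast]
    have : (1 + α * x) ^ (r - h) = (1 + α * x) ^ (1 / 2 : ℂ)
        * (1 + α * x) ^ (((k : ℤ) - h : ℤ) : ℂ) := by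
      rw [← Complex.cpow_add _ _ he]
      congr 1
      push_cast
      rw [hr]
      ring
    rw [this]
    ring
  rw [hval] at hs
  have hz : ∑ i ∈ range h, Ring.choose r i * x ^ i * (i.choose h * α ^ (i - h)) = 0 :=
    sum_eq_zero fun i hi => by rw [Nat.choose_eq_zero_of_lt (mem_range.1 hi)]; simp
  have := (hasSum_nat_add_iff (f := fun n : ℕ => Ring.choose r n * x ^ n
    * ((n.choose h : ℂ) * α ^ (n - h))) (g := (1 + α * x) ^ (1 / 2 : ℂ)
      * coeff h (halfPow k x (1 + α * x))) h).1
    (hasSum_of_forall_eq (fun m => ?_) hs)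
  · rwa [hz, add_zero] at this
  · have hc := Ring.choose_smul_choose r (Nat.le_add_left h m)
    rw [Nat.add_sub_cancel, nsmul_eq_mul] at hc
    rw [Nat.add_sub_cancel, pow_add, mul_pow]
    linear_combination x ^ m * x ^ h * α ^ m * hc

lemma coeff_linear_pow (α : ℂ) (n h : ℕ) :
    coeff h ((C α + X : ℂ⟦X⟧) ^ n) = n.choose h * α ^ (n - h) := by
  have h1 := Polynomial.coeff_X_add_C_pow α n h
  rw [← Polynomial.coeff_coe] at h1
  push_cast at h1
  rw [add_comm, h1, mul_comm]

lemma hasSum_sum_padeForm {a : Fin 3 → ℂ} {x : ℂ} (hx : ∀ j, ‖a j * x‖ < 1) (k g : ℕ) :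
    HasSum (fun n : ℕ => Ring.choose ((k : ℂ) + 1 / 2) n * x ^ n
        * sumRes a (fun _ => k + 1) (Polynomial.X ^ (n + g)))
      (∑ j, (1 + a j * x) ^ (1 / 2 : ℂ) * padeForm a x k j (Polynomial.X ^ g)) := by
  simp only [sumRes, mul_sum]
  refine hasSum_sum fun j _ => ?_
  set Y : ℂ⟦X⟧ := (∏ l ∈ univ.erase j, recipPow (a j - a l) (k + 1)) * (C (a j) + X) ^ g with hY
  have h1 : padeForm a x k j (Polynomial.X ^ g)
      = ∑ p ∈ antidiagonal k, coeff p.1 (halfPow k x (1 + a j * x)) * coeff p.2 Y := by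
    rw [padeForm_apply, padeKernel, map_pow, Polynomial.aeval_X, mul_assoc, ← hY, coeff_mul]
  have h2 : ∀ n, res a (fun _ => k + 1) j (Polynomial.X ^ (n + g))
      = ∑ p ∈ antidiagonal k, ((n.choose p.1 : ℂ) * a j ^ (n - p.1)) * coeff p.2 Y := by
    intro n
    rw [res, coeff_succ_X_mul, map_pow, Polynomial.aeval_X, pow_add,
      show ∀ A B D : ℂ⟦X⟧, A * B * D = A * (D * B) by intros; ring, ← hY, coeff_mul]
    simp only [coeff_linear_pow]
  simp only [h1, h2, mul_sum]
  refine hasSum_sum fun p _ => ?_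
  rw [← mul_assoc]
  exact hasSum_of_forall_eq (fun n => (mul_assoc _ _ _).symm)
    ((hasSum_choose_mul_coeff (hx j) k p.1).mul_right (coeff p.2 Y))

/-- The denominator has degree `3k + 3`, so terms with `n + g < 3k + 2` have zero residue sum. The
others are dominated by the series of `1 / (1 - M‖x‖)^(3k+3)`. -/
lemma norm_sum_padeForm_le {a : Fin 3 → ℂ} (ha : Function.Injective a) {M : ℝ}
    (hM : ∀ i, ‖a i‖ ≤ M) {x : ℂ} (hx : M * ‖x‖ < 1) (k : ℕ) {g : ℕ} (hg : g ≤ 2) :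
    ‖∑ j, (1 + a j * x) ^ (1 / 2 : ℂ) * padeForm a x k j (Polynomial.X ^ g)‖
      ≤ 2 ^ (k + 1) * ‖x‖ ^ (3 * k + 2 - g) * (1 / (1 - M * ‖x‖) ^ (3 * k + 3)) := by
  have hM0 : 0 ≤ M := (norm_nonneg _).trans (hM 0)
  have hax : ∀ j, ‖a j * x‖ < 1 := fun j => by
    rw [norm_mul]
    exact (mul_le_mul_of_nonneg_right (hM j) (norm_nonneg x)).trans_lt hx
  have hgeo := (hasSum_choose_mul_geometric_of_norm_lt_one (3 * k + 2)
    (r := M * ‖x‖) (by rwa [Real.norm_of_nonneg (by positivity)])).mul_left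
      (2 ^ (k + 1) * ‖x‖ ^ (3 * k + 2 - g))
  set s := 3 * k + 2 - g with hs
  set f : ℕ → ℝ := fun n => 2 ^ (k + 1) * ‖x‖ ^ n
    * ((n + g).choose (3 * k + 2) * M ^ (n + g - (3 * k + 2))) with hf
  have hsum : HasSum f (2 ^ (k + 1) * ‖x‖ ^ s * (1 / (1 - M * ‖x‖) ^ (3 * k + 3))) := by
    have hz : ∑ i ∈ range s, f i = 0 := sum_eq_zero fun i hi => by
      have : i + g < 3 * k + 2 := by have := mem_range.1 hi; omega
      simp [hf, Nat.choose_eq_zero_of_lt this]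
    have := (hasSum_nat_add_iff (f := f) s).1 (hasSum_of_forall_eq (fun m => ?_) hgeo)
    · rwa [hz, add_zero] at this
    · simp only [hf]
      rw [show m + s + g = m + (3 * k + 2) by omega, Nat.add_sub_cancel, pow_add, mul_pow]
      ring
  refine (hasSum_sum_padeForm hax k g).norm_le_of_bounded hsum fun n => ?_
  rw [norm_mul, norm_mul, norm_pow]
  refine mul_le_mul (mul_le_mul_of_nonneg_right (norm_choose_half_le k n) (by positivity))
    (norm_sumRes_X_pow_le ha hM _ _ _ ?_) (norm_nonneg _) (by positivity)
  simp
  ring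

/-! ### Integrality and size of the Padé forms -/

/-- The product of the differences of three nodes. -/
def nodeDisc (a : Fin 3 → ℂ) : ℂ := (a 0 - a 1) * (a 1 - a 2) * (a 2 - a 0)

lemma nodeDisc_eq (a : Fin 3 → ℂ) (j : Fin 3) :
    nodeDisc a = (a j - a (j + 1)) * (a (j + 1) - a (j + 2)) * (a (j + 2) - a j) := by
  obtain rfl | rfl | rfl := fin_three_cases j
  · rfl
  · rw [show (1 + 1 : Fin 3) = 2 from rfl, show (1 + 2 : Fin 3) = 0 from rfl, nodeDisc]
    ring
  · rw [show (2 + 1 : Fin 3) = 0 from rfl, show (2 + 2 : Fin 3) = 1 from rfl, nodeDisc]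
    ring

lemma nodeDisc_pow_mul_coeff {a : Fin 3 → ℂ} (ha : Function.Injective a) (j : Fin 3) {k m₁ m₂ : ℕ}
    (h₁ : m₁ ≤ k) (h₂ : m₂ ≤ k) :
    nodeDisc a ^ (2 * k + 1) * (coeff m₁ (recipPow (a j - a (j + 1)) (k + 1))
        * coeff m₂ (recipPow (a j - a (j + 2)) (k + 1)))
      = -(-1) ^ m₁ * (-1) ^ m₂ * ((k + m₁).choose k : ℂ) * ((k + m₂).choose k : ℂ)
        * (a (j + 1) - a (j + 2)) ^ (2 * k + 1) * (a j - a (j + 1)) ^ (k - m₁)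
        * (a j - a (j + 2)) ^ (k - m₂) := by
  have d₁ : a j - a (j + 1) ≠ 0 := sub_ne_zero.2 fun h => fin_three_ne_add_one j (ha h)
  have d₂ : a j - a (j + 2) ≠ 0 := sub_ne_zero.2 fun h => fin_three_ne_add_two j (ha h)
  rw [nodeDisc_eq a j, coeff_recipPow_succ d₁, coeff_recipPow_succ d₂,
    show a (j + 2) - a j = -(a j - a (j + 2)) by ring]
  obtain ⟨c₁, rfl⟩ := Nat.exists_eq_add_of_le h₁
  obtain ⟨c₂, hc₂⟩ := Nat.exists_eq_add_of_le h₂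
  set δ₁ := a j - a (j + 1)
  set δ₂ := a j - a (j + 2)
  have e₁ : δ₁ ^ (2 * (m₁ + c₁) + 1) = δ₁ ^ (m₁ + c₁ + 1 + m₁) * δ₁ ^ (m₁ + c₁ - m₁) := by
    rw [← pow_add]; congr 1; omega
  have e₂ : δ₂ ^ (2 * (m₁ + c₁) + 1) = δ₂ ^ (m₁ + c₁ + 1 + m₂) * δ₂ ^ (m₁ + c₁ - m₂) := by
    rw [← pow_add]; congr 1; omega
  rw [mul_pow, mul_pow, neg_pow, e₁, e₂, show (-1 : ℂ) ^ (2 * (m₁ + c₁) + 1) = -1 from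
    Odd.neg_one_pow ⟨_, rfl⟩]
  field_simp

lemma scaled_padeForm_eq (a : Fin 3 → ℂ) {N : ℂ} (hN : N ≠ 0) (k g : ℕ) (j : Fin 3) :
    4 ^ k * nodeDisc a ^ (2 * k + 1) * N ^ k * padeForm a N⁻¹ k j (Polynomial.X ^ g)
      = ∑ p ∈ antidiagonal k, ∑ q ∈ antidiagonal p.2, ∑ s ∈ antidiagonal q.2,
        4 ^ k * Ring.choose ((k : ℂ) + 1 / 2) p.1 * (N + a j) ^ p.2
          * coeff q.1 ((C (a j) + X : ℂ⟦X⟧) ^ g)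
          * (nodeDisc a ^ (2 * k + 1) * (coeff s.1 (recipPow (a j - a (j + 1)) (k + 1))
            * coeff s.2 (recipPow (a j - a (j + 2)) (k + 1)))) := by
  rw [padeForm_apply, padeKernel, map_pow, Polynomial.aeval_X, prod_erase_fin_three,
    show ∀ A B D : ℂ⟦X⟧, A * B * D = A * (D * B) by intros; ring, coeff_mul, mul_sum]
  refine sum_congr rfl fun p hp => ?_
  have hp' : p.1 + p.2 = k := mem_antidiagonal.1 hp
  have hu : N ^ k * coeff p.1 (halfPow k N⁻¹ (1 + a j * N⁻¹))
      = Ring.choose ((k : ℂ) + 1 / 2) p.1 * (N + a j) ^ p.2 := by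
    rw [halfPow, coeff_mk, show (k : ℤ) - (p.1 : ℕ) = (p.2 : ℕ) by omega, zpow_natCast,
      show 1 + a j * N⁻¹ = (N + a j) * N⁻¹ by field_simp, mul_pow]
    have : N ^ k * (N⁻¹ ^ p.1 * N⁻¹ ^ p.2) = 1 := by
      rw [← pow_add, hp', ← mul_pow, mul_inv_cancel₀ hN, one_pow]
    linear_combination Ring.choose ((k : ℂ) + 1 / 2) p.1 * (N + a j) ^ p.2 * this
  rw [coeff_mul, mul_sum, mul_sum]
  refine sum_congr rfl fun q _ => ?_
  rw [coeff_mul, mul_sum, mul_sum, mul_sum]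
  refine sum_congr rfl fun s _ => ?_
  linear_combination 4 ^ k * nodeDisc a ^ (2 * k + 1) * coeff q.1 ((C (a j) + X : ℂ⟦X⟧) ^ g)
    * (coeff s.1 (recipPow (a j - a (j + 1)) (k + 1))
      * coeff s.2 (recipPow (a j - a (j + 2)) (k + 1))) * hu

/-- Each factor clears one denominator: `4 ^ k` that of the half-integer binomials, `N ^ k` the
powers of `N⁻¹`, `nodeDisc a ^ (2 * k + 1)` the differences of nodes. -/
lemma scaled_padeForm_mem {R : Subring ℂ} {a : Fin 3 → ℂ} (haR : ∀ i, a i ∈ R)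
    (ha : Function.Injective a) {N : ℂ} (hNR : N ∈ R) (hN : N ≠ 0) (k g : ℕ) (j : Fin 3) :
    4 ^ k * nodeDisc a ^ (2 * k + 1) * N ^ k * padeForm a N⁻¹ k j (Polynomial.X ^ g) ∈ R := by
  rw [scaled_padeForm_eq a hN]
  refine sum_mem fun p hp => sum_mem fun q hq => sum_mem fun s hs => ?_
  have hp' : p.1 + p.2 = k := mem_antidiagonal.1 hp
  have hq' : q.1 + q.2 = p.2 := mem_antidiagonal.1 hq
  have hs' : s.1 + s.2 = q.2 := mem_antidiagonal.1 hs
  have hsub : ∀ i l, a i - a l ∈ R := fun i l => sub_mem (haR i) (haR l)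
  refine mul_mem (mul_mem (mul_mem ?_ (pow_mem (add_mem hNR (haR j)) _)) ?_) ?_
  · obtain ⟨z, hz⟩ := exists_int_four_pow_mul_choose_half k p.1
    rw [← hp', pow_add, mul_comm (4 ^ p.1), mul_assoc, hp', hz]
    exact mul_mem (by exact_mod_cast natCast_mem R (4 ^ p.2)) (intCast_mem R z)
  · rw [coeff_linear_pow]
    exact mul_mem (natCast_mem R _) (pow_mem (haR j) _)
  · rw [nodeDisc_pow_mul_coeff ha j (by omega) (by omega)]
    have h1 : (-1 : ℂ) ∈ R := neg_mem (one_mem R)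
    exact mul_mem (mul_mem (mul_mem (mul_mem (mul_mem (mul_mem (neg_mem (pow_mem h1 _))
      (pow_mem h1 _)) (natCast_mem R _)) (natCast_mem R _)) (pow_mem (hsub _ _) _))
      (pow_mem (hsub _ _) _)) (pow_mem (hsub _ _) _)

lemma norm_scaled_padeForm_le {a : Fin 3 → ℂ} (ha : Function.Injective a) {μ : ℝ} (hμ : 1 ≤ μ)
    (haμ : ∀ i, ‖a i‖ ≤ μ) (hdμ : ∀ i j, ‖a i - a j‖ ≤ μ) {N : ℂ} (hN : N ≠ 0)
    (hNμ : 1 ≤ ‖N‖) (k : ℕ) {g : ℕ} (hg : g ≤ 2) (j : Fin 3) :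
    ‖4 ^ k * nodeDisc a ^ (2 * k + 1) * N ^ k * padeForm a N⁻¹ k j (Polynomial.X ^ g)‖
      ≤ 4 * μ ^ 3 * (1024 * μ ^ 4 * (‖N‖ + μ)) ^ k := by
  have hμ0 : 0 ≤ μ := by linarith
  -- `B` bounds a single term; each of the three nested sums costs a further `2 ^ k`, and `4 · 2 ·
  -- 16 · 2³ = 1024`.
  set B : ℝ := 4 ^ k * 2 ^ (k + 1) * (‖N‖ + μ) ^ k * (2 * μ ^ 2) * (16 ^ k * μ ^ (4 * k + 1))
    with hB
  have hB0 : 0 ≤ B := by positivity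
  have hterm : ∀ p ∈ antidiagonal k, ∀ q ∈ antidiagonal p.2, ∀ s ∈ antidiagonal q.2,
      ‖4 ^ k * Ring.choose ((k : ℂ) + 1 / 2) p.1 * (N + a j) ^ p.2
          * coeff q.1 ((C (a j) + X : ℂ⟦X⟧) ^ g)
          * (nodeDisc a ^ (2 * k + 1) * (coeff s.1 (recipPow (a j - a (j + 1)) (k + 1))
            * coeff s.2 (recipPow (a j - a (j + 2)) (k + 1))))‖ ≤ B := by
    intro p hp q hq s hs
    have hp' : p.1 + p.2 = k := mem_antidiagonal.1 hp
    have hq' : q.1 + q.2 = p.2 := mem_antidiagonal.1 hq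
    have hs' : s.1 + s.2 = q.2 := mem_antidiagonal.1 hs
    rw [nodeDisc_pow_mul_coeff ha j (by omega) (by omega), coeff_linear_pow]
    simp only [norm_mul, norm_pow, norm_neg, norm_one, one_pow, one_mul, Complex.norm_natCast]
    have hch : ∀ m ≤ k, ((k + m).choose k : ℝ) ≤ 4 ^ k := by
      intro m hm
      have h1 : (k + m).choose k ≤ 2 ^ (k + m) := Nat.choose_le_two_pow _ _
      have h2 : 2 ^ (k + m) ≤ 2 ^ (2 * k) := Nat.pow_le_pow_right (by norm_num) (by omega)
      rw [pow_mul] at h2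
      exact_mod_cast h1.trans h2
    have c1 : ‖(4 : ℂ)‖ ^ k = 4 ^ k := by norm_num
    have c2 : ‖N + a j‖ ^ p.2 ≤ (‖N‖ + μ) ^ k :=
      (pow_le_pow_left₀ (norm_nonneg _) ((norm_add_le _ _).trans
        (add_le_add_right (haμ j) _)) _).trans (pow_le_pow_right₀ (by linarith) (by omega))
    have c3 : (g.choose q.1 : ℝ) * ‖a j‖ ^ (g - q.1) ≤ 2 * μ ^ 2 := by
      have h1 : g.choose q.1 ≤ 2 := by
        refine (Nat.choose_le_middle q.1 g).trans ?_
        interval_cases g <;> decide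
      have h2 : ‖a j‖ ^ (g - q.1) ≤ μ ^ 2 :=
        (pow_le_pow_left₀ (norm_nonneg _) (haμ j) _).trans (pow_le_pow_right₀ hμ (by omega))
      exact mul_le_mul (by exact_mod_cast h1) h2 (by positivity) (by norm_num)
    have c4 : ((k + s.1).choose k : ℝ) * ((k + s.2).choose k : ℝ)
        * ‖a (j + 1) - a (j + 2)‖ ^ (2 * k + 1) * ‖a j - a (j + 1)‖ ^ (k - s.1)
        * ‖a j - a (j + 2)‖ ^ (k - s.2) ≤ 16 ^ k * μ ^ (4 * k + 1) := by
      have h1 : ((k + s.1).choose k : ℝ) * ((k + s.2).choose k : ℝ) ≤ 16 ^ k := by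
        rw [show (16 : ℝ) ^ k = 4 ^ k * 4 ^ k by rw [← mul_pow]; norm_num]
        exact mul_le_mul (hch _ (by omega)) (hch _ (by omega)) (by positivity) (by positivity)
      have h2 : ∀ (i l : Fin 3) (m n : ℕ), m ≤ n → ‖a i - a l‖ ^ m ≤ μ ^ n := fun i l m n hmn =>
        (pow_le_pow_left₀ (norm_nonneg _) (hdμ i l) _).trans (pow_le_pow_right₀ hμ hmn)
      calc _ ≤ (16 : ℝ) ^ k * μ ^ (2 * k + 1) * μ ^ k * μ ^ k := by
            gcongr
            · exact hdμ _ _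
            · exact h2 _ _ _ _ (by omega)
            · exact h2 _ _ _ _ (by omega)
        _ = _ := by
            rw [show 4 * k + 1 = (2 * k + 1) + k + k by ring, pow_add, pow_add]
            ring
    rw [c1, hB]
    have c5 := norm_choose_half_le k p.1
    gcongr
  rw [scaled_padeForm_eq a hN]
  have hcard : ∀ m ≤ k, (((antidiagonal m).card : ℕ) : ℝ) ≤ 2 ^ k := by
    intro m hm
    rw [Nat.card_antidiagonal]
    have : m + 1 ≤ 2 ^ k := (Nat.add_le_add_right hm 1).trans (Nat.lt_two_pow_self (n := k))
    exact_mod_cast this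
  have hsum : ∀ (m : ℕ) (f : ℕ × ℕ → ℂ) (T : ℝ), m ≤ k → 0 ≤ T →
      (∀ p ∈ antidiagonal m, ‖f p‖ ≤ T) → ‖∑ p ∈ antidiagonal m, f p‖ ≤ 2 ^ k * T := by
    intro m f T hm hT hf
    refine (norm_sum_le_of_le _ hf).trans ?_
    rw [sum_const, nsmul_eq_mul]
    exact mul_le_mul_of_nonneg_right (hcard m hm) hT
  refine (hsum k _ (2 ^ k * (2 ^ k * B)) le_rfl (by positivity) fun p hp => ?_).trans ?_
  · have hp' : p.1 + p.2 = k := mem_antidiagonal.1 hp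
    refine hsum _ _ _ (by omega) (by positivity) fun q hq => ?_
    have hq' : q.1 + q.2 = p.2 := mem_antidiagonal.1 hq
    exact hsum _ _ _ (by omega) hB0 fun s hs => hterm p hp q hq s hs
  · rw [hB, pow_succ 2 k, pow_succ μ (4 * k), pow_mul μ 4 k, mul_pow, mul_pow,
      show (1024 : ℝ) ^ k = 2 ^ k * 2 ^ k * 2 ^ k * 4 ^ k * 2 ^ k * 16 ^ k by
        simp only [← mul_pow]; norm_num]
    apply le_of_eq
    ring

/-- Simultaneous approximation by Padé forms: a nonzero vector `v` over a discrete subring of `ℂ`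
cannot be too close to a multiple of `(1, √(1 + a₁/N), √(1 + a₂/N))`. -/
theorem one_le_pade_bound {R : Subring ℂ} (hR : ∀ y ∈ R, y ≠ 0 → 1 ≤ ‖y‖) {a : Fin 3 → ℂ}
    (haR : ∀ i, a i ∈ R) (ha : Function.Injective a) (ha0 : a 0 = 0) {μ : ℝ} (hμ : 1 ≤ μ)
    (haμ : ∀ i, ‖a i‖ ≤ μ) (hdμ : ∀ i j, ‖a i - a j‖ ≤ μ) {N : ℂ} (hNR : N ∈ R)
    (hNμ : 100 * μ ≤ ‖N‖) {v : Fin 3 → ℂ} (hvR : ∀ i, v i ∈ R) (hv : v ≠ 0) (k : ℕ) :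
    1 ≤ 4 * μ ^ 3 * (1024 * μ ^ 4 * (‖N‖ + μ)) ^ k
        * (‖v 1 - v 0 * (1 + a 1 * N⁻¹) ^ (1 / 2 : ℂ)‖
          + ‖v 2 - v 0 * (1 + a 2 * N⁻¹) ^ (1 / 2 : ℂ)‖)
      + ‖v 0‖ * (4 * ‖nodeDisc a‖) * (16 * ‖nodeDisc a‖ ^ 2 / ‖N‖ ^ 2) ^ k := by
  have hN1 : 1 ≤ ‖N‖ := by linarith
  have hNpos : 0 < ‖N‖ := by linarith
  have hN : N ≠ 0 := norm_pos_iff.1 hNpos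
  have hx : μ * ‖N⁻¹‖ ≤ 1 / 100 := by
    rw [norm_inv, ← div_eq_mul_inv, div_le_iff₀ hNpos]
    linarith
  have he : ∀ j, 1 + a j * N⁻¹ ≠ 0 := fun j h0 => by
    have h1 : ‖a j * N⁻¹‖ = 1 := by
      rw [show a j * N⁻¹ = -1 by linear_combination h0]
      simp
    rw [norm_mul] at h1
    have := mul_le_mul_of_nonneg_right (haμ j) (norm_nonneg N⁻¹)
    linarith
  obtain ⟨g, hg⟩ : ∃ g : Fin 3, ∑ j, v j * padeForm a N⁻¹ k j (Polynomial.X ^ (g : ℕ)) ≠ 0 := by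
    by_contra! h
    exact hv (padeForm_nonsingular ha (inv_ne_zero hN) he k h)
  have hg2 : (g : ℕ) ≤ 2 := by omega
  set P : Fin 3 → ℂ := fun j =>
    4 ^ k * nodeDisc a ^ (2 * k + 1) * N ^ k * padeForm a N⁻¹ k j (Polynomial.X ^ (g : ℕ)) with hP
  set θ : Fin 3 → ℂ := fun j => (1 + a j * N⁻¹) ^ (1 / 2 : ℂ) with hθ
  have hθ0 : θ 0 = 1 := by simp [hθ, ha0]
  have hdisc : nodeDisc a ≠ 0 := by
    have h : ∀ i l, i ≠ l → a i - a l ≠ 0 := fun i l hil => sub_ne_zero.2 fun h => hil (ha h)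
    exact mul_ne_zero (mul_ne_zero (h _ _ (by decide)) (h _ _ (by decide))) (h _ _ (by decide))
  have hsumP : ∑ j, v j * P j = 4 ^ k * nodeDisc a ^ (2 * k + 1) * N ^ k
      * ∑ j, v j * padeForm a N⁻¹ k j (Polynomial.X ^ (g : ℕ)) := by
    rw [mul_sum]
    exact sum_congr rfl fun j _ => by simp only [hP]; ring
  have hone : 1 ≤ ‖∑ j, v j * P j‖ := by
    apply hR
    · exact sum_mem fun j _ => mul_mem (hvR j) (scaled_padeForm_mem haR ha hNR hN k g j)
    · rw [hsumP]
      exact mul_ne_zero (mul_ne_zero (mul_ne_zero (by simp) (pow_ne_zero _ hdisc))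
        (pow_ne_zero _ hN)) hg
  -- Because `θ 0 = 1`, subtracting `v 0 * ∑ θ j * P j` removes the term of index 0 and leaves the
  -- two approximation errors.
  have hsplit : ∑ j, v j * P j = P 1 * (v 1 - v 0 * θ 1) + P 2 * (v 2 - v 0 * θ 2)
      + v 0 * (4 ^ k * nodeDisc a ^ (2 * k + 1) * N ^ k
        * ∑ j, θ j * padeForm a N⁻¹ k j (Polynomial.X ^ (g : ℕ))) := by
    simp only [Fin.sum_univ_three, hθ0, hP]
    ring
  have hPb : ∀ j, ‖P j‖ ≤ 4 * μ ^ 3 * (1024 * μ ^ 4 * (‖N‖ + μ)) ^ k := fun j =>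
    norm_scaled_padeForm_le ha hμ haμ hdμ hN hN1 k hg2 j
  have hsmall := norm_sum_padeForm_le ha haμ (x := N⁻¹) (by linarith) k hg2
  have hrem : ‖4 ^ k * nodeDisc a ^ (2 * k + 1) * N ^ k
      * ∑ j, θ j * padeForm a N⁻¹ k j (Polynomial.X ^ (g : ℕ))‖
      ≤ (4 * ‖nodeDisc a‖) * (16 * ‖nodeDisc a‖ ^ 2 / ‖N‖ ^ 2) ^ k := by
    rw [norm_mul, norm_mul, norm_mul, norm_pow, norm_pow, norm_pow,
      show ‖(4 : ℂ)‖ = 4 by norm_num]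
    have h1 : ‖N⁻¹‖ ^ (3 * k + 2 - g) ≤ (‖N‖ ^ (3 * k))⁻¹ := by
      rw [norm_inv, ← inv_pow]
      exact pow_le_pow_of_le_one (by positivity) (inv_le_one_of_one_le₀ hN1) (by omega)
    have h2 : 1 / (1 - μ * ‖N⁻¹‖) ^ (3 * k + 3) ≤ 2 ^ (k + 1) := by
      rw [show 3 * k + 3 = 3 * (k + 1) by ring, pow_mul, ← one_div_pow]
      refine pow_le_pow_left₀ (by have : 0 ≤ 1 - μ * ‖N⁻¹‖ := by linarith
                                  positivity) ?_ _
      rw [div_le_iff₀ (pow_pos (by linarith) 3)]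
      have : (99 / 100 : ℝ) ^ 3 ≤ (1 - μ * ‖N⁻¹‖) ^ 3 :=
        pow_le_pow_left₀ (by norm_num) (by linarith) 3
      linarith [show (1 : ℝ) ≤ 2 * (99 / 100) ^ 3 by norm_num]
    calc _ ≤ 4 ^ k * ‖nodeDisc a‖ ^ (2 * k + 1) * ‖N‖ ^ k
          * (2 ^ (k + 1) * (‖N‖ ^ (3 * k))⁻¹ * 2 ^ (k + 1)) := by
          refine mul_le_mul_of_nonneg_left (hsmall.trans ?_) (by positivity)
          have : 0 ≤ 1 / (1 - μ * ‖N⁻¹‖) ^ (3 * k + 3) := by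
            have : 0 ≤ 1 - μ * ‖N⁻¹‖ := by linarith
            positivity
          gcongr
      _ = _ := by
          rw [div_pow, mul_pow, ← pow_mul, ← pow_mul, pow_succ, pow_succ,
            show 3 * k = k + 2 * k by ring, pow_add ‖N‖,
            show (16 : ℝ) ^ k = 4 ^ k * 2 ^ k * 2 ^ k by simp only [← mul_pow]; norm_num]
          field_simp
          norm_num
  rw [hsplit] at hone
  have h₁ : ‖P 1 * (v 1 - v 0 * θ 1)‖ ≤ _ := (norm_mul_le _ _).trans
    (mul_le_mul_of_nonneg_right (hPb 1) (norm_nonneg _))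
  have h₂ : ‖P 2 * (v 2 - v 0 * θ 2)‖ ≤ _ := (norm_mul_le _ _).trans
    (mul_le_mul_of_nonneg_right (hPb 2) (norm_nonneg _))
  have h₃ := (norm_mul_le (v 0) _).trans (mul_le_mul_of_nonneg_left hrem (norm_nonneg (v 0)))
  change 1 ≤ _ * (‖v 1 - v 0 * θ 1‖ + ‖v 2 - v 0 * θ 2‖) + _
  rw [mul_add, mul_assoc ‖v 0‖]
  exact hone.trans (norm_add₃_le.trans (add_le_add (add_le_add h₁ h₂) h₃))

end Pade

/-! ### The gap principle -/

/-- Vanishes exactly on the triples `{a, b, c}` with `c = a + b ± 2r`, `r² = ab - 1`. -/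
def regularForm (a b c : ℂ) : ℂ :=
  a ^ 2 + b ^ 2 + c ^ 2 - 2 * a * b - 2 * b * c - 2 * c * a + 4

lemma norm_regularForm_le (a b c : ℂ) :
    ‖regularForm a b c‖ ≤ 2 * (‖a‖ ^ 2 + ‖b‖ ^ 2 + ‖c‖ ^ 2) + 4 := by
  have h : regularForm a b c = c ^ 2 + (-2 * (c * (a + b))) + (a - b) ^ 2 + 4 := by
    rw [regularForm]; ring
  have h1 : ‖regularForm a b c‖ ≤ ‖c‖ ^ 2 + 2 * (‖c‖ * ‖a + b‖) + ‖a - b‖ ^ 2 + 4 := by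
    rw [h]
    refine (norm_add_le _ _).trans (add_le_add (norm_add₃_le.trans (le_of_eq ?_)) (by simp))
    rw [norm_pow, norm_mul, norm_mul, norm_pow]
    simp
  have h2 := parallelogram_law_with_norm ℝ a b
  nlinarith [sq_nonneg (‖c‖ - ‖a + b‖)]

/-- A triple with property `D(-1)` over a discrete subring that is not regular has a large
product. -/
lemma four_mul_norm_le_of_regularForm_ne_zero {R : Subring ℂ} (hR : ∀ y ∈ R, y ≠ 0 → 1 ≤ ‖y‖)
    {a b c r s t : ℂ} (ha : a ∈ R) (hb : b ∈ R) (hc : c ∈ R) (hr : r ∈ R) (hs : s ∈ R) (ht : t ∈ R)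
    (hab : a * b - 1 = r ^ 2) (hac : a * c - 1 = s ^ 2) (hbc : b * c - 1 = t ^ 2)
    (hreg : regularForm a b c ≠ 0) :
    4 * (‖a‖ * ‖b‖ * ‖c‖)
      ≤ 2 * (‖a‖ ^ 2 + ‖b‖ ^ 2 + ‖c‖ ^ 2) + 2 * (‖a‖ + ‖b‖ + ‖c‖) + 5 := by
  -- `e₁` and `e₂` differ by the sign of `rst`; their product is `regularForm` and their sum is
  -- `4abc - 2(a + b + c)`. Both norms being at least 1, `‖e₁‖ + ‖e₂‖ ≤ ‖e₁ e₂‖ + 1`.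
  set e₁ := 2 * a * b * c - (a + b + c) + 2 * r * s * t with he₁
  set e₂ := 2 * a * b * c - (a + b + c) - 2 * r * s * t with he₂
  have hprod : e₁ * e₂ = regularForm a b c := by
    have : e₁ * e₂ = (2 * a * b * c - (a + b + c)) ^ 2 - 4 * r ^ 2 * s ^ 2 * t ^ 2 := by
      rw [he₁, he₂]; ring
    rw [this, ← hab, ← hac, ← hbc, regularForm]
    ring
  have h2 : (2 : ℂ) ∈ R := by exact_mod_cast natCast_mem R 2
  have hm : 2 * a * b * c - (a + b + c) ∈ R := sub_mem
    (mul_mem (mul_mem (mul_mem h2 ha) hb) hc) (add_mem (add_mem ha hb) hc)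
  have hm' : 2 * r * s * t ∈ R := mul_mem (mul_mem (mul_mem h2 hr) hs) ht
  have h₁ : 1 ≤ ‖e₁‖ := hR _ (add_mem hm hm') fun h => hreg (by rw [← hprod, h, zero_mul])
  have h₂ : 1 ≤ ‖e₂‖ := hR _ (sub_mem hm hm') fun h => hreg (by rw [← hprod, h, mul_zero])
  have hP := norm_regularForm_le a b c
  rw [← hprod, norm_mul] at hP
  have hsum : 4 * (‖a‖ * ‖b‖ * ‖c‖) ≤ ‖e₁‖ + ‖e₂‖ + 2 * (‖a‖ + ‖b‖ + ‖c‖) := by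
    have : 4 * (a * b * c) = e₁ + e₂ + 2 * (a + b + c) := by rw [he₁, he₂]; ring
    have h := congrArg norm this
    rw [norm_mul, norm_mul, norm_mul, show ‖(4 : ℂ)‖ = 4 by norm_num] at h
    rw [h]
    refine norm_add₃_le.trans (add_le_add_right ?_ _)
    rw [norm_mul, show ‖(2 : ℂ)‖ = 2 by norm_num]
    exact mul_le_mul_of_nonneg_left norm_add₃_le (by norm_num)
  nlinarith [mul_nonneg (sub_nonneg.2 h₁) (sub_nonneg.2 h₂)]

/-- The hypothesis `h` says that a convex quadratic in `γ` is nonnegative; it is negative at `γ = β`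
and at `γ = β * α`, hence between them. -/
lemma mul_le_of_gap {α β γ : ℝ} (hα0 : 0 ≤ α) (hα : 7 ≤ α ^ 2) (hαβ : α ≤ β) (hβγ : β ≤ γ)
    (h : 4 * (α * β * γ) ≤ 2 * (α ^ 2 + β ^ 2 + γ ^ 2) + 2 * (α + β + γ) + 5) : β * α ≤ γ := by
  by_contra! hc
  have hα' : 2.6 ≤ α := by nlinarith
  have hβ : 2.6 ≤ β := by linarith
  have h1 := mul_nonneg (sub_nonneg.2 hβγ) (sub_nonneg.2 hc.le)
  have h2 : 2 * β - 2 * (α * β) + 2 ≤ 0 := by nlinarith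
  have h3 := mul_nonneg (sub_nonneg.2 hβγ) (neg_nonneg.2 h2)
  have h4 : 2 * α ^ 2 + 2 * α ≤ 2 * β ^ 2 + 2 * β := by nlinarith
  have h5 : 4.4 * β ^ 2 ≤ (4 * α - 6) * β ^ 2 :=
    mul_le_mul_of_nonneg_right (by linarith) (sq_nonneg β)
  nlinarith

/-- Convexity in `γ` again, on `[β, 4.14 β]`. The margin at the right end is small, hence the
precise value `2.6457` for `√7`. -/
lemma not_gap_of_le {α β γ : ℝ} (hα0 : 0 ≤ α) (hα : 7 ≤ α ^ 2) (hαβ : α ≤ β) (hβγ : β ≤ γ)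
    (hγ : γ ≤ 4.14 * β) :
    2 * (α ^ 2 + β ^ 2 + γ ^ 2) + 2 * (α + β + γ) + 5 < 4 * (α * β * γ) := by
  have hα' : 2.6457 ≤ α := by nlinarith
  have hβ : 2.6457 ≤ β := by linarith
  have h1 := mul_nonneg (sub_nonneg.2 hβγ) (sub_nonneg.2 hγ)
  rcases le_total (10.28 * β + 2 - 4 * (α * β)) 0 with h | h
  · have h3 := mul_nonneg (sub_nonneg.2 hβγ) (neg_nonneg.2 h)
    have h4 : 2 * α ^ 2 + 2 * α ≤ 2 * β ^ 2 + 2 * β := by nlinarith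
    have h5 : 4.5 * β ^ 2 ≤ (4 * α - 6) * β ^ 2 :=
      mul_le_mul_of_nonneg_right (by linarith) (sq_nonneg β)
    nlinarith
  · have h3 := mul_nonneg (sub_nonneg.2 hγ) h
    have h4 : 0 ≤ (α - 2.6457) * (16.56 * β ^ 2 - 2 * (α + 2.6457) - 2) :=
      mul_nonneg (by linarith) (by nlinarith)
    nlinarith

/-- Vanishing means `d = b + c ± 2r`. Here `‖r‖² ≤ ‖c‖² + 1 ≤ (8/7)‖c‖²`, `8/7 < 1.07²`, and `4.14 =
2 + 2 · 1.07`. -/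
lemma norm_le_of_regularForm_eq_zero {b c d r : ℂ} (hbc : b * c - 1 = r ^ 2)
    (hreg : regularForm b c d = 0) (hle : ‖b‖ ≤ ‖c‖) (hc : 7 ≤ ‖c‖ ^ 2) :
    ‖d‖ ≤ 4.14 * ‖c‖ := by
  have hr : ‖r‖ ≤ 1.07 * ‖c‖ := by
    have h1 : ‖r‖ ^ 2 ≤ ‖b‖ * ‖c‖ + 1 := by
      rw [← norm_pow, ← hbc, ← norm_mul]
      simpa using norm_sub_le (b * c) 1
    apply le_of_sq_le_sq _ (by positivity)
    nlinarith [norm_nonneg c]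
  have h : (d - b - c - 2 * r) * (d - b - c + 2 * r) = 0 := by
    rw [← hreg, regularForm]
    linear_combination (4 : ℂ) * hbc
  have hbd : ‖b‖ + ‖c‖ + ‖2 * r‖ ≤ 4.14 * ‖c‖ := by
    rw [norm_mul, show ‖(2 : ℂ)‖ = 2 by norm_num]
    linarith
  rcases mul_eq_zero.1 h with h | h
  · rw [show d = b + c + 2 * r by linear_combination h]
    exact norm_add₃_le.trans hbd
  · rw [show d = b + c + -(2 * r) by linear_combination h]
    exact norm_add₃_le.trans (by rwa [norm_neg])

/-- Pairwise property `D(-1)` over the subring `R`. -/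
def SquarePair (R : Subring ℂ) (a b : ℂ) : Prop := ∃ r ∈ R, a * b - 1 = r ^ 2

/-- If `{b, c, d}` were regular, `d` would be comparable with `c`, forcing `{x₁, c, d}` and `{x₂, c,
d}` to be regular as well. But `regularForm · c d` is a monic quadratic and cannot have three
distinct roots. -/
lemma norm_mul_le_of_five {R : Subring ℂ} (hR : ∀ y ∈ R, y ≠ 0 → 1 ≤ ‖y‖) {x₁ x₂ b c d : ℂ}
    (hx₁ : x₁ ∈ R) (hx₂ : x₂ ∈ R) (hb : b ∈ R) (hc : c ∈ R) (hd : d ∈ R)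
    (h₁₂ : x₁ ≠ x₂) (h₁b : x₁ ≠ b) (h₂b : x₂ ≠ b)
    (h₁c : SquarePair R x₁ c) (h₁d : SquarePair R x₁ d) (h₂c : SquarePair R x₂ c)
    (h₂d : SquarePair R x₂ d) (hbc : SquarePair R b c) (hbd : SquarePair R b d)
    (hcd : SquarePair R c d) (n₁ : 7 ≤ ‖x₁‖ ^ 2) (n₂ : 7 ≤ ‖x₂‖ ^ 2) (nb : 7 ≤ ‖b‖ ^ 2)
    (l₁ : ‖x₁‖ ≤ ‖c‖) (l₂ : ‖x₂‖ ≤ ‖c‖) (lb : ‖b‖ ≤ ‖c‖) (lc : ‖c‖ ≤ ‖d‖) :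
    ‖c‖ * ‖b‖ ≤ ‖d‖ := by
  have gap : ∀ x ∈ R, SquarePair R x c → SquarePair R x d → regularForm x c d ≠ 0 →
      4 * (‖x‖ * ‖c‖ * ‖d‖)
        ≤ 2 * (‖x‖ ^ 2 + ‖c‖ ^ 2 + ‖d‖ ^ 2) + 2 * (‖x‖ + ‖c‖ + ‖d‖) + 5 := by
    rintro x hx ⟨r, hr, hxc⟩ ⟨s, hs, hxd⟩ hreg
    obtain ⟨t, ht, hcd⟩ := hcd
    exact four_mul_norm_le_of_regularForm_ne_zero hR hx hc hd hr hs ht hxc hxd hcd hreg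
  by_cases hreg : regularForm b c d = 0
  · exfalso
    obtain ⟨r, -, hr⟩ := id hbc
    have hle := norm_le_of_regularForm_eq_zero hr hreg lb (by nlinarith [norm_nonneg b])
    have key : ∀ x ∈ R, SquarePair R x c → SquarePair R x d → 7 ≤ ‖x‖ ^ 2 → ‖x‖ ≤ ‖c‖ →
        regularForm x c d = 0 := fun x hx hxc hxd nx lx => by
      by_contra hne
      exact absurd (gap x hx hxc hxd hne)
        (not_le.2 (not_gap_of_le (norm_nonneg x) nx lx lc hle))
    have e₁ := key x₁ hx₁ h₁c h₁d n₁ l₁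
    have e₂ := key x₂ hx₂ h₂c h₂d n₂ l₂
    have hsum : ∀ x y : ℂ, regularForm x c d = 0 → regularForm y c d = 0 → x ≠ y →
        x + y = 2 * c + 2 * d := fun x y hx hy hxy => by
      have : (x - y) * (x + y - 2 * c - 2 * d) = 0 := by
        rw [regularForm] at hx hy
        linear_combination hx - hy
      linear_combination (mul_eq_zero.1 this).resolve_left (sub_ne_zero.2 hxy)
    exact h₂b (by linear_combination hsum _ _ e₁ e₂ h₁₂ - hsum _ _ e₁ hreg h₁b)
  · exact mul_le_of_gap (norm_nonneg b) nb lb lc (gap b hb hbc hbd hreg)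

/-! ### Quadruples with large gaps do not exist -/

/-- Since `p + w` and `p - w` differ by `2w`, one of them has norm at least `‖w‖`; the sign is
chosen so that the other one remains. -/
lemma exists_sign_norm_mul_le (p w : ℂ) :
    ∃ σ : ℂ, (σ = 1 ∨ σ = -1) ∧ ‖σ * p - w‖ * ‖w‖ ≤ ‖p ^ 2 - w ^ 2‖ := by
  have hprod : ‖p - w‖ * ‖p + w‖ = ‖p ^ 2 - w ^ 2‖ := by
    rw [← norm_mul]; congr 1; ring
  have hsum : 2 * ‖w‖ ≤ ‖p + w‖ + ‖p - w‖ := by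
    have := norm_sub_le (p + w) (p - w)
    rwa [show p + w - (p - w) = 2 * w by ring, norm_mul, show ‖(2 : ℂ)‖ = 2 by norm_num] at this
  rcases le_total ‖w‖ ‖p + w‖ with h | h
  · refine ⟨1, Or.inl rfl, ?_⟩
    rw [one_mul, ← hprod]
    exact mul_le_mul_of_nonneg_left h (norm_nonneg _)
  · refine ⟨-1, Or.inr rfl, ?_⟩
    rw [show -1 * p - w = -(p + w) by ring, norm_neg, ← hprod, mul_comm ‖p - w‖]
    exact mul_le_mul_of_nonneg_left (by linarith) (norm_nonneg _)

/-- The approximation to `√(1 - 1/(ac))` provided by a `D(-1)`-triple `{a, c, d}`. -/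
lemma exists_approx {R : Subring ℂ} {a b c d s x z : ℂ} (hbR : b ∈ R) (hsR : s ∈ R)
    (hxR : x ∈ R) (ha : 1 ≤ ‖a‖) (hb : 1 ≤ ‖b‖) (hac : ‖a‖ ≤ ‖c‖) (hc2 : 2 ≤ ‖c‖)
    (hs : a * c - 1 = s ^ 2) (hx : a * d - 1 = x ^ 2) (hz : c * d - 1 = z ^ 2) (hz0 : z ≠ 0) :
    ∃ p ∈ R, ‖p - a * b * z * (1 + -b * (a * b * c)⁻¹) ^ (1 / 2 : ℂ)‖
      ≤ 8 * ‖b‖ * ‖c‖ / ‖z‖ := by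
  have ha0 : a ≠ 0 := norm_pos_iff.1 (by linarith)
  have hb0 : b ≠ 0 := norm_pos_iff.1 (by linarith)
  have hc0 : c ≠ 0 := norm_pos_iff.1 (by linarith)
  have hz' : 0 < ‖z‖ := norm_pos_iff.2 hz0
  set θ := (1 + -b * (a * b * c)⁻¹) ^ (1 / 2 : ℂ) with hθ
  have hθ2 : θ ^ 2 = 1 - (a * c)⁻¹ := by
    rw [hθ, ← Complex.cpow_nat_mul]
    norm_num
    field_simp
    ring
  have hinv : ‖(a * c)⁻¹‖ ≤ 1 / 2 := by
    rw [norm_inv, norm_mul, one_div]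
    exact inv_anti₀ (by norm_num) (by nlinarith)
  have hθn : 1 / 2 ≤ ‖θ‖ := by
    have h1 : 1 - ‖(a * c)⁻¹‖ ≤ ‖θ‖ ^ 2 := by
      rw [← norm_pow, hθ2]
      simpa using norm_sub_norm_le (1 : ℂ) (a * c)⁻¹
    nlinarith [norm_nonneg θ]
  obtain ⟨σ, hσ, hle⟩ := exists_sign_norm_mul_le (b * s * x) (a * b * z * θ)
  refine ⟨σ * (b * s * x), ?_, ?_⟩
  · have : σ ∈ R := by rcases hσ with rfl | rfl <;> simp [one_mem]
    exact mul_mem this (mul_mem (mul_mem hbR hsR) hxR)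
  · have hdiff : (b * s * x) ^ 2 - (a * b * z * θ) ^ 2 = b ^ 2 * (a * c - 1) * (a - c) / c := by
      rw [mul_pow, mul_pow, mul_pow (a * b * z), hθ2, mul_pow (a * b), ← hs, ← hx, ← hz]
      field_simp
      ring
    have hdn : ‖(b * s * x) ^ 2 - (a * b * z * θ) ^ 2‖ ≤ 4 * ‖b‖ ^ 2 * ‖a‖ * ‖c‖ := by
      rw [hdiff, norm_div, norm_mul, norm_mul, norm_pow, div_le_iff₀ (by linarith)]
      have h1 : ‖a * c - 1‖ ≤ 2 * (‖a‖ * ‖c‖) := by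
        have := norm_sub_le (a * c) 1
        rw [norm_mul, norm_one] at this
        nlinarith
      have h2 : ‖a - c‖ ≤ 2 * ‖c‖ := (norm_sub_le _ _).trans (by linarith)
      calc ‖b‖ ^ 2 * ‖a * c - 1‖ * ‖a - c‖ ≤ ‖b‖ ^ 2 * (2 * (‖a‖ * ‖c‖)) * (2 * ‖c‖) := by gcongr
        _ = _ := by ring
    have hw : ‖a‖ * ‖b‖ * ‖z‖ / 2 ≤ ‖a * b * z * θ‖ := by
      rw [norm_mul, norm_mul, norm_mul, div_eq_mul_one_div]
      gcongr
    have hpos : 0 < ‖a‖ * ‖b‖ / 2 := by positivity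
    have h3 := (mul_le_mul_of_nonneg_left hw (norm_nonneg _)).trans (hle.trans hdn)
    rw [le_div_iff₀ hz']
    refine le_of_mul_le_mul_right ?_ hpos
    calc _ = _ := ?_
      _ ≤ _ := h3
      _ = _ := ?_
    · ring
    · ring

/-- The inequality between the sizes of the elements of a `D(-1)`-quadruple given by the Padé form
of order `k`. -/
lemma one_le_of_quadruple {R : Subring ℂ} (hR : ∀ y ∈ R, y ≠ 0 → 1 ≤ ‖y‖) {a b c d z : ℂ}
    (haR : a ∈ R) (hbR : b ∈ R) (hcR : c ∈ R) (hzR : z ∈ R) (hab : a ≠ b)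
    (ha : 1 ≤ ‖a‖) (hle : ‖a‖ ≤ ‖b‖) (hbc : ‖b‖ ≤ ‖c‖) (hc : 200 ≤ ‖c‖)
    (hac' : SquarePair R a c) (hbc' : SquarePair R b c) (had' : SquarePair R a d)
    (hbd' : SquarePair R b d) (hz : c * d - 1 = z ^ 2) (hz0 : z ≠ 0) (k : ℕ) :
    1 ≤ 2 ^ 9 * ‖b‖ ^ 4 * ‖c‖ * (2 ^ 15 * ‖b‖ ^ 6 * ‖c‖) ^ k / ‖z‖
      + 2 ^ 3 * ‖b‖ ^ 5 * ‖z‖ * (2 ^ 6 * ‖b‖ ^ 2 / ‖c‖ ^ 2) ^ k := by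
  obtain ⟨s, hsR, hs⟩ := hac'
  obtain ⟨t, htR, ht⟩ := hbc'
  obtain ⟨x, hxR, hx⟩ := had'
  obtain ⟨y, hyR, hy⟩ := hbd'
  have hb : 1 ≤ ‖b‖ := ha.trans hle
  have ha0 : a ≠ 0 := norm_pos_iff.1 (by linarith)
  have hb0 : b ≠ 0 := norm_pos_iff.1 (by linarith)
  have hz' : 0 < ‖z‖ := norm_pos_iff.2 hz0
  obtain ⟨p₁, hp₁R, hp₁⟩ := exists_approx (b := b) hbR hsR hxR ha hb (hle.trans hbc)
    (by linarith) hs hx hz hz0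
  obtain ⟨p₂, hp₂R, hp₂⟩ := exists_approx (b := a) haR htR hyR hb ha hbc
    (by linarith) ht hy hz hz0
  rw [mul_comm b a] at hp₂
  set N := a * b * c with hN
  have hNn : ‖N‖ = ‖a‖ * ‖b‖ * ‖c‖ := by rw [hN, norm_mul, norm_mul]
  -- With `N = abc` these nodes give `1 - 1/(ac)` and `1 - 1/(bc)`; `abz` is the common denominator,
  -- and `μ = 2‖b‖` will bound the nodes and their differences.
  set e : Fin 3 → ℂ := ![0, -b, -a] with he
  set v : Fin 3 → ℂ := ![a * b * z, p₁, p₂] with hv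
  have hinj : Function.Injective e := by
    intro i j hij
    fin_cases i <;> fin_cases j <;> simp_all [eq_comm]
  have hdiffn : ‖a - b‖ ≤ 2 * ‖b‖ := (norm_sub_le _ _).trans (by linarith)
  have hNbig : 100 * (2 * ‖b‖) ≤ ‖N‖ := by
    rw [hNn]
    nlinarith [mul_le_mul ha hc (by norm_num) (by linarith : 0 ≤ ‖a‖)]
  have key := one_le_pade_bound hR (a := e) (μ := 2 * ‖b‖) (N := N) (v := v)
    (by
      intro i
      fin_cases i
      · exact zero_mem R
      · exact neg_mem hbR
      · exact neg_mem haR)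
    hinj rfl (by linarith)
    (by
      intro i
      fin_cases i
      · simp [he]
      · simp [he]; linarith
      · simp [he]; linarith)
    (by
      intro i j
      fin_cases i <;> fin_cases j <;> simp [he] <;>
        first
        | linarith
        | exact hdiffn
        | (rw [neg_add_eq_sub]; first | exact hdiffn | (rw [norm_sub_rev]; exact hdiffn)))
    (mul_mem (mul_mem haR hbR) hcR) hNbig
    (by
      intro i
      fin_cases i
      · exact mul_mem (mul_mem haR hbR) hzR
      · exact hp₁R
      · exact hp₂R)
    (fun h => mul_ne_zero (mul_ne_zero ha0 hb0) hz0 (congrFun h 0)) k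
  have hdisc : ‖nodeDisc e‖ ≤ 2 * ‖a‖ * ‖b‖ ^ 2 := by
    have : nodeDisc e = b * (a - b) * (-a) := by
      change (0 - -b) * (-b - -a) * (-a - 0) = _
      ring
    rw [this, norm_mul, norm_mul, norm_neg]
    nlinarith [mul_le_mul_of_nonneg_left hdiffn
      (mul_nonneg (norm_nonneg a) (norm_nonneg b))]
  have hQ : 1024 * (2 * ‖b‖) ^ 4 * (‖N‖ + 2 * ‖b‖) ≤ 2 ^ 15 * ‖b‖ ^ 6 * ‖c‖ := by
    have h1 : ‖N‖ + 2 * ‖b‖ ≤ 2 * (‖b‖ * ‖b‖ * ‖c‖) := by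
      have : ‖N‖ ≤ ‖b‖ * ‖b‖ * ‖c‖ := by rw [hNn]; gcongr
      linarith
    calc _ ≤ 1024 * (2 * ‖b‖) ^ 4 * (2 * (‖b‖ * ‖b‖ * ‖c‖)) := by gcongr
      _ = _ := by ring
  have hE : 16 * ‖nodeDisc e‖ ^ 2 / ‖N‖ ^ 2 ≤ 2 ^ 6 * ‖b‖ ^ 2 / ‖c‖ ^ 2 := by
    have h1 : ‖nodeDisc e‖ ^ 2 ≤ (2 * ‖a‖ * ‖b‖ ^ 2) ^ 2 := by gcongr
    rw [hNn, div_le_div_iff₀ (by positivity) (by positivity)]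
    calc _ ≤ 16 * (2 * ‖a‖ * ‖b‖ ^ 2) ^ 2 * ‖c‖ ^ 2 := by gcongr
      _ = _ := by ring
  have hv0 : ‖v 0‖ ≤ ‖b‖ ^ 2 * ‖z‖ := by
    simp only [hv, Matrix.cons_val_zero, norm_mul]
    rw [sq]
    gcongr
  have happ : ‖v 1 - v 0 * (1 + e 1 * N⁻¹) ^ (1 / 2 : ℂ)‖
      + ‖v 2 - v 0 * (1 + e 2 * N⁻¹) ^ (1 / 2 : ℂ)‖ ≤ 16 * ‖b‖ * ‖c‖ / ‖z‖ := by
    have h2 : 8 * ‖a‖ * ‖c‖ / ‖z‖ ≤ 8 * ‖b‖ * ‖c‖ / ‖z‖ := by gcongr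
    have h3 : 16 * ‖b‖ * ‖c‖ / ‖z‖ = 8 * ‖b‖ * ‖c‖ / ‖z‖ + 8 * ‖b‖ * ‖c‖ / ‖z‖ := by ring
    rw [h3]
    exact add_le_add hp₁ (hp₂.trans h2)
  refine key.trans (add_le_add ?_ ?_)
  · calc _ ≤ 4 * (2 * ‖b‖) ^ 3 * (2 ^ 15 * ‖b‖ ^ 6 * ‖c‖) ^ k * (16 * ‖b‖ * ‖c‖ / ‖z‖) := by
          gcongr
      _ = _ := by ring
  · calc _ ≤ ‖b‖ ^ 2 * ‖z‖ * (4 * (2 * ‖a‖ * ‖b‖ ^ 2)) * (2 ^ 6 * ‖b‖ ^ 2 / ‖c‖ ^ 2) ^ k := by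
          gcongr
      _ ≤ ‖b‖ ^ 2 * ‖z‖ * (4 * (2 * ‖b‖ * ‖b‖ ^ 2)) * (2 ^ 6 * ‖b‖ ^ 2 / ‖c‖ ^ 2) ^ k := by
          gcongr
      _ = _ := by ring

/-- Sizes with large gaps contradict the inequalities coming from the Padé forms. -/
lemma exists_pade_order {b c z L B C Z : ℝ} (hb : 0 < b) (hc : 0 < c) (hz : 0 < z)
    (hL : Real.log 2 = L) (hB : Real.log b = B) (hC : Real.log c = C) (hZ : Real.log z = Z)
    (hLB : 7 * L ≤ B) (hBC : 34 * B ≤ C) (hCZ : 7 * C + 83 * B ≤ Z) :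
    ∃ k : ℕ, 2 ^ 9 * b ^ 4 * c * (2 ^ 15 * b ^ 6 * c) ^ k / z
      + 2 ^ 3 * b ^ 5 * z * (2 ^ 6 * b ^ 2 / c ^ 2) ^ k < 1 := by
  have hL0 : 0 < L := by rw [← hL]; exact Real.log_pos (by norm_num)
  have e2 : (2 : ℝ) = Real.exp L := by rw [← hL, Real.exp_log (by norm_num)]
  have eb : b = Real.exp B := by rw [← hB, Real.exp_log hb]
  have ec : c = Real.exp C := by rw [← hC, Real.exp_log hc]
  have ez : z = Real.exp Z := by rw [← hZ, Real.exp_log hz]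
  -- Per unit of `k`, the second term decays by `E` and the first grows by `Q`, in logarithms.
  -- Taking `k = ⌈T / E⌉` makes the second term less than 1/2. The factor 34 yields `Q ≤ 13/20 E`,
  -- which with `hCZ` keeps the first below 1/2.
  set E := 2 * C - 2 * B - 6 * L with hE
  set Q := 15 * L + 6 * B + C with hQ
  set T := 5 * L + 5 * B + Z with hT
  have hE0 : 0 < E := by linarith
  have hQE : Q ≤ 13 / 20 * E := by linarith
  obtain ⟨k, hk1, hk2⟩ : ∃ k : ℕ, T ≤ k * E ∧ (k : ℝ) * E ≤ T + E := by
    refine ⟨⌈T / E⌉₊, ?_, ?_⟩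
    · have := Nat.le_ceil (T / E)
      rwa [div_le_iff₀ hE0] at this
    · have := (Nat.ceil_lt_add_one (div_nonneg (by linarith : (0 : ℝ) ≤ T) hE0.le)).le
      calc _ ≤ (T / E + 1) * E := mul_le_mul_of_nonneg_right this hE0.le
        _ = _ := by field_simp
  have hkQ : (k : ℝ) * Q ≤ 13 / 20 * T + Q := by
    rcases k with _ | k
    · simp
      linarith
    · push_cast at hk2 ⊢
      have := mul_le_mul_of_nonneg_left hQE (Nat.cast_nonneg (α := ℝ) k)
      nlinarith
  refine ⟨k, ?_⟩
  have h1 : 2 ^ 9 * b ^ 4 * c * (2 ^ 15 * b ^ 6 * c) ^ k / z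
      = Real.exp (9 * L + 4 * B + C + k * Q - Z) := by
    rw [hQ, Real.exp_sub, Real.exp_add, Real.exp_add, Real.exp_add, Real.exp_nat_mul,
      Real.exp_add, Real.exp_add, ← ec, ← ez]
    rw [show (9 : ℝ) * L = (9 : ℕ) * L by norm_num, show (4 : ℝ) * B = (4 : ℕ) * B by norm_num,
      show (15 : ℝ) * L = (15 : ℕ) * L by norm_num, show (6 : ℝ) * B = (6 : ℕ) * B by norm_num,
      Real.exp_nat_mul, Real.exp_nat_mul, Real.exp_nat_mul, Real.exp_nat_mul, ← e2, ← eb]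
  have h2 : 2 ^ 3 * b ^ 5 * z * (2 ^ 6 * b ^ 2 / c ^ 2) ^ k
      = Real.exp (3 * L + 5 * B + Z - k * E) := by
    have : 3 * L + 5 * B + Z - k * E
        = (3 : ℕ) * L + (5 : ℕ) * B + Z + k * ((6 : ℕ) * L + (2 : ℕ) * B - (2 : ℕ) * C) := by
      rw [hE]; push_cast; ring
    rw [this, Real.exp_add, Real.exp_add, Real.exp_add, Real.exp_nat_mul, Real.exp_nat_mul,
      Real.exp_nat_mul, Real.exp_sub, Real.exp_add, Real.exp_nat_mul, Real.exp_nat_mul,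
      Real.exp_nat_mul, ← e2, ← eb, ← ec, ← ez]
  have hhalf : Real.exp (-L) = 1 / 2 := by rw [Real.exp_neg, ← e2]; norm_num
  have h3 : Real.exp (9 * L + 4 * B + C + k * Q - Z) < Real.exp (-L) :=
    Real.exp_lt_exp.2 (by linarith)
  have h4 : Real.exp (3 * L + 5 * B + Z - k * E) < Real.exp (-L) :=
    Real.exp_lt_exp.2 (by linarith)
  rw [h1, h2]
  linarith

/-- From `‖z‖² ≥ ‖c‖‖d‖ / 2`, the hypothesis on `d` gives `7 C + 83 B ≤ Z` in `exists_pade_order`,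
one `B` absorbing the factor 2. The bound `128 = 2⁷` gives `7 L ≤ B`. -/
theorem not_quadruple_of_gaps {R : Subring ℂ} (hR : ∀ y ∈ R, y ≠ 0 → 1 ≤ ‖y‖) {a b c d : ℂ}
    (haR : a ∈ R) (hbR : b ∈ R) (hcR : c ∈ R) (hab : a ≠ b)
    (ha : 1 ≤ ‖a‖) (hle : ‖a‖ ≤ ‖b‖) (hb : 128 ≤ ‖b‖)
    (hac : SquarePair R a c) (hbc : SquarePair R b c) (had : SquarePair R a d)
    (hbd : SquarePair R b d) (hcd : SquarePair R c d)
    (hBC : 34 * Real.log ‖b‖ ≤ Real.log ‖c‖)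
    (hCD : 13 * Real.log ‖c‖ + 168 * Real.log ‖b‖ ≤ Real.log ‖d‖) (hd0 : d ≠ 0) (hc0 : c ≠ 0) :
    False := by
  obtain ⟨z, hzR, hz⟩ := hcd
  have hL0 : 0 < Real.log 2 := Real.log_pos (by norm_num)
  have hB : 7 * Real.log 2 ≤ Real.log ‖b‖ := by
    rw [show 7 * Real.log 2 = Real.log (2 ^ 7) by rw [Real.log_pow]; norm_num]
    exact Real.log_le_log (by norm_num) (by linarith)
  have hcpos : 0 < ‖c‖ := norm_pos_iff.2 hc0
  have hdpos : 0 < ‖d‖ := norm_pos_iff.2 hd0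
  have hc : 200 ≤ ‖c‖ := by
    have : Real.log (2 ^ 8) ≤ Real.log ‖c‖ := by rw [Real.log_pow]; push_cast; linarith
    have := (Real.log_le_log_iff (by norm_num) hcpos).1 this
    linarith
  have hd1 : 1 ≤ ‖d‖ := by
    have : Real.log 1 ≤ Real.log ‖d‖ := by rw [Real.log_one]; linarith
    exact (Real.log_le_log_iff (by norm_num) hdpos).1 this
  have hzn : ‖c‖ * ‖d‖ / 2 ≤ ‖z‖ ^ 2 := by
    rw [← norm_pow, ← hz]
    have := norm_sub_norm_le (c * d) 1
    rw [norm_mul, norm_one] at this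
    nlinarith
  have hzpos : 0 < ‖z‖ := by
    have : 0 < ‖z‖ ^ 2 := lt_of_lt_of_le (by positivity) hzn
    exact norm_pos_iff.2 fun h => by simp [h] at this
  have hZ : 7 * Real.log ‖c‖ + 83 * Real.log ‖b‖ ≤ Real.log ‖z‖ := by
    have h1 := Real.log_le_log (by positivity) hzn
    rw [Real.log_pow, Real.log_div (by positivity) (by norm_num),
      Real.log_mul hcpos.ne' hdpos.ne'] at h1
    push_cast at h1
    linarith
  have hbc' : ‖b‖ ≤ ‖c‖ :=
    (Real.log_le_log_iff (by linarith) hcpos).1 (by linarith)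
  obtain ⟨k, hk⟩ := exists_pade_order (b := ‖b‖) (c := ‖c‖) (z := ‖z‖) (by linarith) hcpos hzpos
    rfl rfl rfl rfl hB hBC hZ
  exact absurd (one_le_of_quadruple hR haR hbR hcR hzR hab ha hle hbc' hc hac hbc had hbd hz
    (norm_pos_iff.1 hzpos) k) (not_le.2 hk)

/-! ### Counting the elements with `‖x‖² ≥ 7`. -/

open Finset

lemma SquarePair.symm {R : Subring ℂ} {a b : ℂ} (h : SquarePair R a b) : SquarePair R b a := by
  obtain ⟨r, hr, h⟩ := h
  exact ⟨r, hr, by rw [mul_comm, h]⟩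

/-- At most twenty elements of a `D(-1)`-tuple satisfy `‖x‖² ≥ 7`. -/
theorem card_le_of_seven_le {R : Subring ℂ} (hR : ∀ y ∈ R, y ≠ 0 → 1 ≤ ‖y‖) {A : Finset ℂ}
    (hAR : ∀ x ∈ A, x ∈ R) (hA7 : ∀ x ∈ A, 7 ≤ ‖x‖ ^ 2)
    (hA : ∀ x ∈ A, ∀ y ∈ A, x ≠ y → SquarePair R x y) : #A ≤ 20 := by
  by_contra! hcard
  set f : Fin #A → ℂ := fun i => (A.equivFin.symm i : ℂ) with hf
  have hfinj : Function.Injective f := fun i j h => A.equivFin.symm.injective (Subtype.ext h)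
  set σ := Tuple.sort (fun i => ‖f i‖)
  have hmono : Monotone ((fun i => ‖f i‖) ∘ σ) := Tuple.monotone_sort _
  set y : Fin 21 → ℂ := fun i => f (σ ⟨i, by omega⟩) with hy
  have hyA : ∀ i, y i ∈ A := fun i => (A.equivFin.symm (σ ⟨i, by omega⟩)).2
  have hyinj : Function.Injective y := fun i j h => by
    have := σ.injective (hfinj h)
    exact Fin.ext (Fin.mk.inj_iff.1 this)
  have hyle : ∀ i j, i ≤ j → ‖y i‖ ≤ ‖y j‖ := fun i j h => hmono (by exact h)
  have hyne : ∀ i j, i ≠ j → y i ≠ y j := fun i j h e => h (hyinj e)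
  have hysq : ∀ i j, i ≠ j → SquarePair R (y i) (y j) := fun i j h =>
    hA _ (hyA i) _ (hyA j) (hyne i j h)
  have hy0 : ∀ i, 0 < ‖y i‖ := fun i => by
    have := hA7 _ (hyA i)
    by_contra! h
    have h0 : ‖y i‖ = 0 := le_antisymm h (norm_nonneg _)
    rw [h0] at this
    norm_num at this
  set L : ℕ → ℝ := fun i => if h : i < 21 then Real.log ‖y ⟨i, h⟩‖ else 0 with hL
  have hLval : ∀ (i : ℕ) (h : i < 21), L i = Real.log ‖y ⟨i, h⟩‖ := fun i h => dif_pos h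
  have hL7 : ∀ i < 21, Real.log 7 ≤ 2 * L i := fun i h => by
    rw [hLval i h, show 2 * Real.log ‖y ⟨i, h⟩‖ = Real.log (‖y ⟨i, h⟩‖ ^ 2) by
      rw [Real.log_pow]; norm_num]
    exact Real.log_le_log (by norm_num) (hA7 _ (hyA _))
  -- The elements `i` and `i + 1` serve only to exclude regularity, so the recursion starts at index
  -- 4.
  have hgrow : ∀ i, i + 4 < 21 → L (i + 3) + L (i + 2) ≤ L (i + 4) := by
    intro i hi
    rw [hLval (i + 3) (by omega), hLval (i + 2) (by omega), hLval (i + 4) hi,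
      ← Real.log_mul (hy0 _).ne' (hy0 _).ne']
    refine Real.log_le_log (mul_pos (hy0 _) (hy0 _)) ?_
    refine norm_mul_le_of_five hR (x₁ := y ⟨i, by omega⟩) (x₂ := y ⟨i + 1, by omega⟩)
      (hAR _ (hyA _)) (hAR _ (hyA _)) (hAR _ (hyA _)) (hAR _ (hyA _)) (hAR _ (hyA _))
      (hyne _ _ ?_) (hyne _ _ ?_) (hyne _ _ ?_) (hysq _ _ ?_) (hysq _ _ ?_) (hysq _ _ ?_)
      (hysq _ _ ?_) (hysq _ _ ?_) (hysq _ _ ?_) (hysq _ _ ?_) (hA7 _ (hyA _)) (hA7 _ (hyA _))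
      (hA7 _ (hyA _)) (hyle _ _ ?_) (hyle _ _ ?_) (hyle _ _ ?_) (hyle _ _ ?_) <;>
    simp [Fin.le_def]
  have hlog7 : 0 < Real.log 7 := Real.log_pos (by norm_num)
  have hpos : ∀ i < 21, 0 < L i := fun i h => by linarith [hL7 i h]
  have g4 := hgrow 0 (by norm_num)
  have g5 := hgrow 1 (by norm_num)
  have g6 := hgrow 2 (by norm_num)
  have g7 := hgrow 3 (by norm_num)
  have g8 := hgrow 4 (by norm_num)
  have g9 := hgrow 5 (by norm_num)
  have g10 := hgrow 6 (by norm_num)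
  have g11 := hgrow 7 (by norm_num)
  have g12 := hgrow 8 (by norm_num)
  have g13 := hgrow 9 (by norm_num)
  have g14 := hgrow 10 (by norm_num)
  have g15 := hgrow 11 (by norm_num)
  have g16 := hgrow 12 (by norm_num)
  have g17 := hgrow 13 (by norm_num)
  have g18 := hgrow 14 (by norm_num)
  have g19 := hgrow 15 (by norm_num)
  have g20 := hgrow 16 (by norm_num)
  norm_num at g4 g5 g6 g7 g8 g9 g10 g11 g12 g13 g14 g15 g16 g17 g18 g19 g20
  have p5 := hpos 5 (by norm_num)
  -- Fibonacci coefficients: `L 14 ≥ 34 L 6 + 21 L 5`, then `L 20 ≥ 13 L 14 + 8 L 13` with `L 13 ≥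
  -- 21 L 6`, and `8 · 21 = 168`.
  have hBC : 34 * L 6 ≤ L 14 := by linarith
  have hCD : 13 * L 14 + 168 * L 6 ≤ L 20 := by linarith
  -- `L 6 ≥ 3 L 3 + 2 L 2` gives `‖y 6‖² ≥ 7⁵ > 128²`.
  have hb : 128 ≤ ‖y 6‖ := by
    have h2 := hL7 2 (by norm_num)
    have h3 := hL7 3 (by norm_num)
    have h6 : 5 * Real.log 7 ≤ 2 * L 6 := by linarith
    rw [hLval 6 (by norm_num),
      show 5 * Real.log 7 = Real.log (7 ^ 5) by rw [Real.log_pow]; norm_num,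
      show 2 * Real.log ‖y ⟨6, by norm_num⟩‖ = Real.log (‖y ⟨6, by norm_num⟩‖ ^ 2) by
        rw [Real.log_pow]; norm_num,
      Real.log_le_log_iff (by norm_num) (pow_pos (hy0 _) 2)] at h6
    change 128 ≤ ‖y ⟨6, by norm_num⟩‖
    nlinarith [norm_nonneg (y ⟨6, by norm_num⟩)]
  have ha : 1 ≤ ‖y 5‖ := hR _ (hAR _ (hyA 5)) (norm_pos_iff.1 (hy0 5))
  rw [hLval 6 (by norm_num), hLval 14 (by norm_num)] at hBC
  rw [hLval 6 (by norm_num), hLval 14 (by norm_num), hLval 20 (by norm_num)] at hCD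
  exact not_quadruple_of_gaps hR (a := y 5) (b := y 6) (c := y 14) (d := y 20)
    (hAR _ (hyA _)) (hAR _ (hyA _)) (hAR _ (hyA _)) (hyne _ _ (by decide)) ha
    (hyle _ _ (by decide)) hb (hysq _ _ (by decide)) (hysq _ _ (by decide))
    (hysq _ _ (by decide)) (hysq _ _ (by decide)) (hysq _ _ (by decide)) hBC hCD
    (norm_pos_iff.1 (hy0 _)) (norm_pos_iff.1 (hy0 _))

/-! ### Elements of small norm -/

/-- Coordinates on a subring of `ℂ` all of whose elements have integral squared absolute value:
`x = (T + V √(-D)) / 2`. -/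
lemma exists_coordinates {R : Subring ℂ} (hN : ∀ x ∈ R, ∃ n : ℕ, ‖x‖ ^ 2 = n) :
    ∃ (D : ℕ) (T V : ℂ → ℤ), 3 ≤ D ∧
      (∀ x ∈ R, ((T x ^ 2 + D * V x ^ 2 : ℤ) : ℝ) = 4 * ‖x‖ ^ 2) ∧
      ∀ x ∈ R, ∀ y ∈ R, T x = T y → V x = V y → x = y := by
  have hsq : ∀ x : ℂ, ‖x‖ ^ 2 = x.re ^ 2 + x.im ^ 2 := fun x => by
    rw [← Complex.normSq_eq_norm_sq, Complex.normSq_apply]; ring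
  have hT : ∀ x : ℂ, ∃ t : ℤ, x ∈ R → (t : ℝ) = 2 * x.re := by
    intro x
    by_cases hx : x ∈ R
    · obtain ⟨n, hn⟩ := hN x hx
      obtain ⟨m, hm⟩ := hN (x + 1) (add_mem hx (one_mem R))
      refine ⟨(m : ℤ) - n - 1, fun _ => ?_⟩
      rw [hsq] at hn hm
      simp only [Complex.add_re, Complex.add_im, Complex.one_re, Complex.one_im] at hm
      push_cast
      rw [← hn, ← hm]
      ring
    · exact ⟨0, fun h => absurd h hx⟩
  choose T hT using hT
  have him : ∀ x ∈ R, ∃ n : ℕ, (2 * x.im) ^ 2 = ((4 * n - T x ^ 2 : ℤ) : ℝ) := by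
    intro x hx
    obtain ⟨n, hn⟩ := hN x hx
    refine ⟨n, ?_⟩
    push_cast
    rw [← hn, hT x hx, hsq]
    ring
  let ψ : ℂ →+ ℝ :=
    { toFun := fun x => 2 * x.im
      map_zero' := by simp
      map_add' := fun x y => by simp [mul_add] }
  set H : AddSubgroup ℝ := R.toAddSubgroup.map ψ with hH
  have hmem : ∀ x ∈ R, 2 * x.im ∈ H := fun x hx => ⟨x, hx, rfl⟩
  -- The values `2 im x` have integral squares `4n - T²`, so none lies strictly between 0 and 1 and
  -- they form a cyclic group. If its generator is nonzero, its square is `D`.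
  obtain ⟨b, hb⟩ := AddSubgroup.cyclic_of_isolated_zero (H := H) (a := 1) one_pos (by
    rw [Set.disjoint_left]
    rintro _ ⟨x, hx, rfl⟩ ⟨h0, h1⟩
    change 0 < 2 * x.im at h0
    change 2 * x.im < 1 at h1
    obtain ⟨n, hn⟩ := him x hx
    have h2 : (0 : ℝ) < ((4 * n - T x ^ 2 : ℤ) : ℝ) := by rw [← hn]; positivity
    have h3 : ((4 * n - T x ^ 2 : ℤ) : ℝ) < 1 := by rw [← hn]; nlinarith
    have h2' : 0 < (4 * n - T x ^ 2 : ℤ) := by exact_mod_cast h2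
    have h3' : (4 * n - T x ^ 2 : ℤ) < 1 := by exact_mod_cast h3
    omega)
  have hV : ∀ x : ℂ, ∃ v : ℤ, x ∈ R → (v : ℝ) * b = 2 * x.im := by
    intro x
    by_cases hx : x ∈ R
    · have := hmem x hx
      rw [hb, AddSubgroup.mem_closure_singleton] at this
      obtain ⟨v, hv⟩ := this
      exact ⟨v, fun _ => by rw [← hv, zsmul_eq_mul]⟩
    · exact ⟨0, fun h => absurd h hx⟩
  by_cases hb0 : b = 0
  -- Here `R` is real and `V = 0`, so any `D ≥ 3` would do.
  · refine ⟨3, T, fun _ => 0, le_rfl, ?_, ?_⟩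
    · intro x hx
      obtain ⟨v, hv⟩ := hV x
      have h0 := hv hx
      rw [hb0, mul_zero] at h0
      push_cast
      rw [hT x hx, hsq]
      nlinarith
    · intro x hx y hy hxy _
      obtain ⟨v, hv⟩ := hV x
      obtain ⟨w, hw⟩ := hV y
      have h0 := hv hx
      have h1 := hw hy
      rw [hb0, mul_zero] at h0 h1
      have h2 := hT x hx
      rw [hxy, hT y hy] at h2
      exact Complex.ext (by linarith) (by linarith)
  · choose V hV using hV
    obtain ⟨x₀, hx₀, hbx⟩ : b ∈ H := by rw [hb]; exact AddSubgroup.mem_closure_singleton_self b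
    change 2 * x₀.im = b at hbx
    obtain ⟨n, hn⟩ := him x₀ hx₀
    rw [hbx] at hn
    have hpos : 0 < (4 * n - T x₀ ^ 2 : ℤ) := by
      have : (0 : ℝ) < ((4 * n - T x₀ ^ 2 : ℤ) : ℝ) := by rw [← hn]; positivity
      exact_mod_cast this
    -- `4n - T²` is 0 or 3 modulo 4.
    have h3 : 3 ≤ (4 * n - T x₀ ^ 2 : ℤ) := by
      rcases Int.even_or_odd' (T x₀) with ⟨t, ht | ht⟩
      · rw [ht] at hpos ⊢
        ring_nf at hpos ⊢
        omega
      · rw [ht] at hpos ⊢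
        ring_nf at hpos ⊢
        omega
    obtain ⟨D, hD⟩ := Int.eq_ofNat_of_zero_le hpos.le
    rw [hD] at hn h3
    refine ⟨D, T, V, by exact_mod_cast h3, ?_, ?_⟩
    · intro x hx
      push_cast at hn ⊢
      rw [← hn, hT x hx, mul_comm (b ^ 2), ← mul_pow, hV x hx, hsq]
      ring
    · intro x hx y hy hxy hv
      have h2 := hT x hx
      have h4 := hV x hx
      rw [hxy, hT y hy] at h2
      rw [hv, hV y hy] at h4
      exact Complex.ext (by linarith) (by linarith)

/-- The coordinates of the elements with `lo ≤ ‖x‖² ≤ hi`. -/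
noncomputable def coordinateBox (D lo hi : ℕ) : Finset (ℤ × ℤ) :=
  (Icc (-4 : ℤ) 4 ×ˢ Icc (-2 : ℤ) 2).filter fun p =>
    4 * (lo : ℤ) ≤ p.1 ^ 2 + D * p.2 ^ 2 ∧ p.1 ^ 2 + D * p.2 ^ 2 ≤ 4 * hi ∧
      (p.1 ^ 2 + D * p.2 ^ 2) % 4 = 0

lemma card_le_card_coordinateBox {R : Subring ℂ} (hN : ∀ x ∈ R, ∃ n : ℕ, ‖x‖ ^ 2 = n) :
    ∃ D : ℕ, 3 ≤ D ∧ ∀ (lo hi : ℕ) (S : Finset ℂ), hi ≤ 6 → (∀ x ∈ S, x ∈ R) →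
      (∀ x ∈ S, (lo : ℝ) ≤ ‖x‖ ^ 2 ∧ ‖x‖ ^ 2 ≤ hi) → #S ≤ #(coordinateBox D lo hi) := by
  obtain ⟨D, T, V, hD, hTV, hinj⟩ := exists_coordinates hN
  refine ⟨D, hD, fun lo hi S hhi hSR hS => ?_⟩
  refine card_le_card_of_injOn (fun x => (T x, V x)) ?_ ?_
  · intro x hx
    obtain ⟨n, hn⟩ := hN x (hSR x hx)
    have h1 := hTV x (hSR x hx)
    obtain ⟨h2, h3⟩ := hS x hx
    rw [hn] at h1 h2 h3
    have h1' : T x ^ 2 + D * V x ^ 2 = 4 * n := by exact_mod_cast h1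
    have h2' : lo ≤ n := by exact_mod_cast h2
    have h3' : n ≤ hi := by exact_mod_cast h3
    have hD' : (3 : ℤ) ≤ D := by exact_mod_cast hD
    have hDV : 3 * V x ^ 2 ≤ D * V x ^ 2 := mul_le_mul_of_nonneg_right hD' (sq_nonneg _)
    have hn6 : (n : ℤ) ≤ 6 := by omega
    -- `T² + 3V² ≤ 24` is the source of the ranges `|T| ≤ 4` and `|V| ≤ 2` in `coordinateBox`.
    have hT' : T x ^ 2 ≤ 24 := by nlinarith [sq_nonneg (V x)]
    have hV' : V x ^ 2 ≤ 8 := by nlinarith [sq_nonneg (T x)]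
    have : (T x, V x) ∈ coordinateBox D lo hi := by
      simp only [coordinateBox, mem_filter, mem_product, mem_Icc, h1']
      refine ⟨⟨⟨?_, ?_⟩, ?_, ?_⟩, ?_, ?_, ?_⟩
      · nlinarith
      · nlinarith
      · nlinarith
      · nlinarith
      · omega
      · omega
      · omega
    exact this
  · intro x hx y hy h
    exact hinj x (hSR x hx) y (hSR y hy) (congrArg Prod.fst h) (congrArg Prod.snd h)

/-- For `D > 24` the second coordinate must vanish; the remaining values of `D` are checked by
enumeration. -/
lemma card_coordinateBox_le {D : ℕ} (hD : 3 ≤ D) :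
    #(coordinateBox D 2 6) ≤ 16 ∧ #(coordinateBox D 0 3) ≤ 13 := by
  rcases Nat.lt_or_ge 24 D with h | h
  · have hsub : ∀ lo hi, hi ≤ 6 → #(coordinateBox D lo hi) ≤ 9 := by
      intro lo hi hhi
      refine (card_le_card (t := Icc (-4 : ℤ) 4 ×ˢ {0}) fun p hp => ?_).trans (by decide)
      simp only [coordinateBox, mem_filter, mem_product, mem_Icc] at hp
      obtain ⟨⟨h1, -⟩, -, h2, -⟩ := hp
      have hp2 : p.2 = 0 := by
        by_contra hne
        have h3 : 0 < p.2 ^ 2 := by positivity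
        have h4 : (25 : ℤ) * p.2 ^ 2 ≤ D * p.2 ^ 2 :=
          mul_le_mul_of_nonneg_right (by exact_mod_cast h) h3.le
        have : (hi : ℤ) ≤ 6 := by exact_mod_cast hhi
        nlinarith [sq_nonneg p.1]
      exact mem_product.2 ⟨mem_Icc.2 h1, mem_singleton.2 hp2⟩
    exact ⟨(hsub 2 6 le_rfl).trans (by norm_num), (hsub 0 3 (by norm_num)).trans (by norm_num)⟩
  · interval_cases D <;> decide +kernel

/-- At most sixteen elements of a `D(-1)`-tuple satisfy `‖x‖² ≤ 6`. -/
theorem card_le_of_le_six {R : Subring ℂ} (hN : ∀ x ∈ R, ∃ n : ℕ, ‖x‖ ^ 2 = n) {A : Finset ℂ}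
    (hAR : ∀ x ∈ A, x ∈ R) (hA0 : ∀ x ∈ A, x ≠ 0) (hA6 : ∀ x ∈ A, ‖x‖ ^ 2 ≤ 6)
    (hA : ∀ x ∈ A, ∀ y ∈ A, x ≠ y → SquarePair R x y) : #A ≤ 16 := by
  obtain ⟨D, hD, hbox⟩ := card_le_card_coordinateBox hN
  obtain ⟨h16, h13⟩ := card_coordinateBox_le hD
  -- If `‖u‖ = 1`, then `b ↦ √(ub - 1)` is injective with `‖√(ub - 1)‖² ≤ √6 + 1 < 4`, so there are
  -- at most 13 + 1 elements. Otherwise all squared norms lie between 2 and 6.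
  by_cases hu : ∃ u ∈ A, ‖u‖ ^ 2 = 1
  · obtain ⟨u, huA, hu⟩ := hu
    have hu1 : ‖u‖ = 1 := by nlinarith [norm_nonneg u]
    have hex : ∀ b : ℂ, ∃ x : ℂ, b ∈ A.erase u → x ∈ R ∧ u * b - 1 = x ^ 2 := by
      intro b
      by_cases hb : b ∈ A.erase u
      · obtain ⟨x, hx⟩ := hA u huA b (mem_of_mem_erase hb) (ne_of_mem_erase hb).symm
        exact ⟨x, fun _ => hx⟩
      · exact ⟨0, fun h => absurd h hb⟩
    choose x hx using hex
    have hinj : Set.InjOn x (A.erase u : Finset ℂ) := by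
      intro b hb c hc hbc
      have h1 := (hx b hb).2
      rw [hbc, ← (hx c hc).2] at h1
      have : u * (b - c) = 0 := by linear_combination h1
      exact sub_eq_zero.1 ((mul_eq_zero.1 this).resolve_left (hA0 u huA))
    have hle : #((A.erase u).image x) ≤ #(coordinateBox D 0 3) := by
      refine hbox 0 3 _ (by norm_num) ?_ ?_
      · intro y hy
        obtain ⟨b, hb, rfl⟩ := mem_image.1 hy
        exact (hx b hb).1
      · intro y hy
        obtain ⟨b, hb, rfl⟩ := mem_image.1 hy
        obtain ⟨hxR, hxb⟩ := hx b hb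
        refine ⟨by simp, ?_⟩
        obtain ⟨n, hn⟩ := hN _ hxR
        have hb6 := hA6 b (mem_of_mem_erase hb)
        have h1 : ‖x b‖ ^ 2 ≤ ‖b‖ + 1 := by
          rw [← norm_pow, ← hxb]
          have := norm_sub_le (u * b) 1
          rwa [norm_mul, hu1, one_mul, norm_one] at this
        have h2 : ‖b‖ < 3 := by nlinarith [norm_nonneg b]
        rw [hn] at h1 ⊢
        have : (n : ℝ) < 4 := by linarith
        have : n < 4 := by exact_mod_cast this
        exact_mod_cast Nat.le_of_lt_succ this
    rw [card_image_of_injOn hinj, card_erase_of_mem huA] at hle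
    omega
  · push Not at hu
    refine (hbox 2 6 A le_rfl hAR fun x hx => ⟨?_, by exact_mod_cast hA6 x hx⟩).trans h16
    obtain ⟨n, hn⟩ := hN x (hAR x hx)
    have h1 := hu x hx
    have h0 : ‖x‖ ^ 2 ≠ 0 := pow_ne_zero 2 (norm_ne_zero_iff.2 (hA0 x hx))
    rw [hn] at h1 h0 ⊢
    have h1' : n ≠ 1 := by exact_mod_cast h1
    have h0' : n ≠ 0 := by exact_mod_cast h0
    exact_mod_cast (by omega : 2 ≤ n)

/-- A `D(-1)`-tuple in a subring of `ℂ` with integral squared absolute values has at most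
thirty-six elements. -/
theorem card_le_thirtySix {R : Subring ℂ} (hN : ∀ x ∈ R, ∃ n : ℕ, ‖x‖ ^ 2 = n) {A : Finset ℂ}
    (hAR : ∀ x ∈ A, x ∈ R) (hA0 : ∀ x ∈ A, x ≠ 0)
    (hA : ∀ x ∈ A, ∀ y ∈ A, x ≠ y → SquarePair R x y) : #A ≤ 36 := by
  have hR : ∀ y ∈ R, y ≠ 0 → 1 ≤ ‖y‖ := by
    intro y hy hy0
    obtain ⟨n, hn⟩ := hN y hy
    have h0 : ‖y‖ ^ 2 ≠ 0 := pow_ne_zero 2 (norm_ne_zero_iff.2 hy0)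
    rw [hn] at h0
    have h1 : (1 : ℝ) ≤ n := by
      exact_mod_cast Nat.one_le_iff_ne_zero.2 (by exact_mod_cast h0)
    rw [← hn] at h1
    nlinarith [norm_nonneg y]
  have hsmall : #(A.filter fun x => ‖x‖ ^ 2 ≤ 6) ≤ 16 := by
    refine card_le_of_le_six hN (R := R) ?_ ?_ ?_ ?_
    · exact fun x hx => hAR x (mem_filter.1 hx).1
    · exact fun x hx => hA0 x (mem_filter.1 hx).1
    · exact fun x hx => (mem_filter.1 hx).2
    · exact fun x hx y hy => hA x (mem_filter.1 hx).1 y (mem_filter.1 hy).1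
  have hlarge : #(A.filter fun x => ¬ ‖x‖ ^ 2 ≤ 6) ≤ 20 := by
    refine card_le_of_seven_le hR ?_ ?_ ?_
    · exact fun x hx => hAR x (mem_filter.1 hx).1
    · intro x hx
      obtain ⟨hxA, hx6⟩ := mem_filter.1 hx
      obtain ⟨n, hn⟩ := hN x (hAR x hxA)
      rw [hn] at hx6 ⊢
      have : 6 < n := by exact_mod_cast not_le.1 hx6
      exact_mod_cast this
    · exact fun x hx y hy => hA x (mem_filter.1 hx).1 y (mem_filter.1 hy).1
  have := card_filter_add_card_filter_not (s := A) (fun x => ‖x‖ ^ 2 ≤ 6)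
  omega

/-! ### Imaginary quadratic fields -/

open NumberField in
-- The field has a single infinite place and it is complex, so the product formula for `|N(x)|` has
-- the single factor `‖φ x‖²`.
lemma exists_nat_eq_norm_sq (K : Type*) [Field K] [NumberField K]
    [Algebra.IsQuadraticExtension ℚ K] [IsTotallyComplex K] (φ : K →+* ℂ)
    (x : 𝓞 K) : ∃ n : ℕ, ‖φ x‖ ^ 2 = n := by
  have hcard : Fintype.card (InfinitePlace K) = 1 := by
    have h1 := InfinitePlace.card_eq_nrRealPlaces_add_nrComplexPlaces K
    have h2 := InfinitePlace.card_add_two_mul_card_eq_rank K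
    rw [IsTotallyComplex.nrRealPlaces_eq_zero] at h1 h2
    rw [Algebra.IsQuadraticExtension.finrank_eq_two] at h2
    omega
  have hsub : Subsingleton (InfinitePlace K) := Fintype.card_le_one_iff_subsingleton.1 hcard.le
  have hprod := InfinitePlace.prod_eq_abs_norm (x : K)
  rw [Fintype.prod_subsingleton _ (InfinitePlace.mk φ), InfinitePlace.apply] at hprod
  have hm : (InfinitePlace.mk φ).mult = 2 :=
    InfinitePlace.mult_isComplex ⟨_, IsTotallyComplex.isComplex _⟩
  rw [hm, ← Algebra.coe_norm_int] at hprod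
  exact ⟨(Algebra.norm ℤ x).natAbs, by rw [hprod]; simp [Nat.cast_natAbs]⟩

end DiophantineTuple

/-! ### Passage from the ring of integers to a subring of `ℂ`. -/

theorem theorem1 (K : Type*) [Field K] [NumberField K] [Algebra.IsQuadraticExtension ℚ K]
    [NumberField.IsTotallyComplex K] (m : ℕ) (hm : 36 < m) :
    ¬ ∃ a : Fin m → NumberField.RingOfIntegers K, IsDiophantineTuple (-1) a := by
  rintro ⟨a, ha⟩
  obtain ⟨φ⟩ : Nonempty (K →+* ℂ) := inferInstance
  set ψ : NumberField.RingOfIntegers K →+* ℂ :=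
    φ.comp (algebraMap (NumberField.RingOfIntegers K) K) with hψ
  have hinj : Function.Injective ψ :=
    φ.injective.comp NumberField.RingOfIntegers.coe_injective
  have hsq : ∀ i j, i ≠ j → DiophantineTuple.SquarePair ψ.range (ψ (a i)) (ψ (a j)) := by
    have key : ∀ i j, i < j → DiophantineTuple.SquarePair ψ.range (ψ (a i)) (ψ (a j)) := by
      intro i j hij
      obtain ⟨r, hr⟩ := ha.isSquare i j hij
      refine ⟨ψ r, ⟨r, rfl⟩, ?_⟩
      have := congrArg ψ hr
      simp only [map_add, map_mul, map_neg, map_one] at this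
      linear_combination this
    intro i j hij
    rcases lt_or_gt_of_ne hij with h | h
    · exact key i j h
    · exact (key j i h).symm
  have h := DiophantineTuple.card_le_thirtySix (R := ψ.range)
    (A := Finset.univ.image fun i => ψ (a i)) ?_ ?_ ?_ ?_
  · rw [Finset.card_image_of_injective _ (f := fun i => ψ (a i)) (hinj.comp ha.injective),
      Finset.card_univ, Fintype.card_fin] at h
    omega
  · rintro _ ⟨x, rfl⟩
    exact DiophantineTuple.exists_nat_eq_norm_sq K φ x
  · intro x hx
    obtain ⟨i, -, rfl⟩ := Finset.mem_image.1 hx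
    exact ⟨a i, rfl⟩
  · intro x hx
    obtain ⟨i, -, rfl⟩ := Finset.mem_image.1 hx
    exact (map_ne_zero_iff ψ hinj).2 (ha.ne_zero i)
  · intro x hx y hy hxy
    obtain ⟨i, -, rfl⟩ := Finset.mem_image.1 hx
    obtain ⟨j, -, rfl⟩ := Finset.mem_image.1 hy
    exact hsq i j fun h => hxy (by rw [h])
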